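/- A mosaic dissection is a dissection of an axis-parallel rectangle into finitely many axis-parallel rectangles with disjoint interiors (its rooms) that has no cross junction, i.e. no point is a corner of four rooms. Its segments are the maximal horizontal and vertical line segments contained in the union of the edges of the rooms. A segment $s$ supports a room $r$ from the left (right, bottom, top) if it contains the left (right, bottom, top) edge of $r$. Two mosaic dissections are equivalent if there are a bijection between their rooms and a bijection between their segments that preserve these four relations in both directions; a mosaic floorplan is an equivalence class. For $k\in\mathbb N$, let $\mathrm{HFO}_k$ be the set of mosaic floorplans having a representative that can be obtained from a single rectangle by repeatedly replacing a room $r$ by the rooms of a mosaic dissection of $r$ with at most $k$ rooms. Theorem. For every integer $k\ge 7$, $\mathrm{HFO}_{k-1}\subseteq \mathrm{HFO}_k$ and $\mathrm{HFO}_k\setminus \mathrm{HFO}_{k-1}\neq\emptyset$; that is, $\mathrm{HFO}_{k-1}\subsetneq \mathrm{HFO}_k$ for every $k\ge 7$, so the levels form a strict infinite hierarchy. -/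

import Mathlib

namespace Floorplan

/-- A nondegenerate axis-parallel closed rectangle `[x₁, x₂] × [y₁, y₂]` in the plane. -/
structure Rect where
  x₁ : ℝ
  x₂ : ℝ
  y₁ : ℝ
  y₂ : ℝ
  hx : x₁ < x₂
  hy : y₁ < y₂

/-- The four sides of a rectangle. -/
inductive Side where
  | left
  | right
  | bottom
  | top

namespace Rect

/-- The closed region of the plane occupied by a rectangle. -/
def region (r : Rect) : Set (ℝ × ℝ) := Set.Icc r.x₁ r.x₂ ×ˢ Set.Icc r.y₁ r.y₂

/-- The open region strictly inside a rectangle. -/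
def inner (r : Rect) : Set (ℝ × ℝ) := Set.Ioo r.x₁ r.x₂ ×ˢ Set.Ioo r.y₁ r.y₂

/-- The edge of a rectangle on a given side. -/
def edge (r : Rect) : Side → Set (ℝ × ℝ)
  | Side.left => {r.x₁} ×ˢ Set.Icc r.y₁ r.y₂
  | Side.right => {r.x₂} ×ˢ Set.Icc r.y₁ r.y₂
  | Side.bottom => Set.Icc r.x₁ r.x₂ ×ˢ {r.y₁}
  | Side.top => Set.Icc r.x₁ r.x₂ ×ˢ {r.y₂}

end Rect

/-- `D` is a dissection of the rectangle `R` into finitely many rooms: the rooms cover exactly `R`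
and no two of them overlap. -/
def IsDissection (R : Rect) (D : Finset Rect) : Prop :=
  (⋃ r ∈ D, r.region) = R.region ∧
    ∀ r ∈ D, ∀ s ∈ D, r ≠ s → Disjoint r.inner s.inner

/-- `p` is a cross junction: four rooms, lying to the south-west, south-east, north-west and
north-east of `p`, have `p` as a corner. -/
def IsCrossJunction (D : Finset Rect) (p : ℝ × ℝ) : Prop :=
  ∃ a ∈ D, ∃ b ∈ D, ∃ c ∈ D, ∃ d ∈ D,
    p = (a.x₂, a.y₂) ∧ p = (b.x₁, b.y₂) ∧ p = (c.x₂, c.y₁) ∧ p = (d.x₁, d.y₁)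

/-- A mosaic dissection of `R`: a dissection without cross junctions. -/
def IsMosaic (R : Rect) (D : Finset Rect) : Prop :=
  IsDissection R D ∧ ∀ p, ¬ IsCrossJunction D p

/-- A geometric mosaic dissection of some rectangle; mosaic floorplans are equivalence
classes of these. -/
structure MosaicDissection where
  outer : Rect
  rooms : Finset Rect
  isMosaic : IsMosaic outer rooms

/-- The drawing of a dissection: the union of all edges of all rooms. -/
def drawing (D : Finset Rect) : Set (ℝ × ℝ) := ⋃ r ∈ D, ⋃ d : Side, r.edge d

/-- A nondegenerate horizontal or vertical line segment in the plane. -/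
def IsAxisSegment (s : Set (ℝ × ℝ)) : Prop :=
  (∃ x a b : ℝ, a < b ∧ s = {x} ×ˢ Set.Icc a b) ∨
    (∃ a b y : ℝ, a < b ∧ s = Set.Icc a b ×ˢ {y})

/-- The segments of a dissection: the maximal line segments of its drawing. -/
def IsSegment (D : Finset Rect) (s : Set (ℝ × ℝ)) : Prop :=
  Maximal (fun t => IsAxisSegment t ∧ t ⊆ drawing D) s

/-- The segment `s` supports the room `r` from the side `d`, that is, `s` and `r` hold the
left-, right-, bottom- or top-seg-room relation. -/
def SegRoom (d : Side) (s : Set (ℝ × ℝ)) (r : Rect) : Prop := r.edge d ⊆ s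

/-- Two dissections are equivalent if their rooms and their segments can be matched so that the
same seg-room relations hold. -/
def Equivalent (f g : MosaicDissection) : Prop :=
  ∃ (φ : {r // r ∈ f.rooms} ≃ {r // r ∈ g.rooms})
    (ψ : {s // IsSegment f.rooms s} ≃ {s // IsSegment g.rooms s}),
    ∀ (d : Side) (s : {s // IsSegment f.rooms s}) (r : {r // r ∈ f.rooms}),
      SegRoom d s.1 r.1 ↔ SegRoom d (ψ s).1 (φ r).1

/-- Equivalence of mosaic dissections is an equivalence relation. -/
instance mosaicSetoid : Setoid MosaicDissection where
  r := Equivalent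
  iseqv :=
    { refl := fun _ => ⟨Equiv.refl _, Equiv.refl _, fun _ _ _ => Iff.rfl⟩
      symm := by
        rintro f g ⟨φ, ψ, h⟩
        refine ⟨φ.symm, ψ.symm, fun d s r => ?_⟩
        have := h d (ψ.symm s) (φ.symm r)
        simp only [Equiv.apply_symm_apply] at this
        exact this.symm
      trans := by
        rintro f g e ⟨φ, ψ, h⟩ ⟨φ', ψ', h'⟩
        exact ⟨φ.trans φ', ψ.trans ψ', fun d s r =>
          (h d s r).trans (h' d (ψ s) (φ r))⟩ }

/-- Mosaic floorplans: mosaic dissections up to equivalence. -/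
def MosaicFloorplan : Type := Quotient mosaicSetoid

open Classical in
/-- `Hierarchical k R D`: the set of rooms `D` is obtained from the single rectangle `R` by
repeatedly replacing a room `r` by the rooms of a mosaic dissection of `r` with at most
`k` rooms. -/
inductive Hierarchical (k : ℕ) (R : Rect) : Finset Rect → Prop
  | single : Hierarchical k R {R}
  | embed (D E : Finset Rect) (r : Rect) : Hierarchical k R D → r ∈ D → IsMosaic r E →
      E.card ≤ k → Hierarchical k R (D.erase r ∪ E)

/-- `HFO k`: the mosaic floorplans that are hierarchical of order `k`. -/
def HFO (k : ℕ) : Set MosaicFloorplan :=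
  {F | ∃ f : MosaicDissection, (Quotient.mk mosaicSetoid f : MosaicFloorplan) = F ∧
    Hierarchical k f.outer f.rooms}

end Floorplan

/-! Inclusion is immediate, since a replacement by at most `k - 1` rooms is one by at most `k`. For
strictness, a mosaic dissection with exactly `k` rooms is needed that is not equivalent to any
hierarchical dissection of order `k - 1`.

A hierarchical dissection with more rooms than its order contains a proper block: at least two, but
not all, of its rooms fill a rectangle (`Hierarchical.exists_block`). Being a block is geometric and
need not survive equivalence, so it is weakened to `Interlocked`, which speaks only of rooms
supported by common segments. It holds for blocks because, without cross junctions, a segment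
through the inside of a block cannot leave its frame (`IsBlock.interlocked`). The seg-room
bijections transport it, whence `notMem_HFO`.

The witnesses are spirals of `p + q + 4` rooms with `p = q` or `p = q + 1`. Two distinct rooms
differ in the position of some edge, so in an interlocked set one of these edges is internal; this
pulls in a neighbour, and the growth continues along the spiral until every room belongs to the set
(`Spiral.eq_rooms_of_one_lt_card`). -/

namespace Floorplan

/-! ### Rectangles and their edges in coordinates. -/

namespace Side

/-- The side opposite to a given one. -/
def opp : Side → Side
  | left => right
  | right => left
  | bottom => top
  | top => bottom

end Side

namespace Rect

/-- The coordinate of the line carrying the edge of a rectangle on a given side. -/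
def coord (r : Rect) : Side → ℝ
  | Side.left => r.x₁
  | Side.right => r.x₂
  | Side.bottom => r.y₁
  | Side.top => r.y₂

/-- The lower end of the edge on a given side, as a coordinate along that edge. -/
def lo (r : Rect) : Side → ℝ
  | Side.left => r.y₁
  | Side.right => r.y₁
  | Side.bottom => r.x₁
  | Side.top => r.x₁

/-- The upper end of the edge on a given side, as a coordinate along that edge. -/
def hi (r : Rect) : Side → ℝ
  | Side.left => r.y₂
  | Side.right => r.y₂
  | Side.bottom => r.x₂
  | Side.top => r.x₂

theorem region_subset_iff {r s : Rect} :
    r.region ⊆ s.region ↔ (s.x₁ ≤ r.x₁ ∧ r.x₂ ≤ s.x₂) ∧ s.y₁ ≤ r.y₁ ∧ r.y₂ ≤ s.y₂ := by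
  have hx := r.hx
  have hy := r.hy
  constructor
  · intro h
    have h1 := @h (r.x₁, r.y₁) ⟨⟨le_rfl, hx.le⟩, le_rfl, hy.le⟩
    have h2 := @h (r.x₂, r.y₂) ⟨⟨hx.le, le_rfl⟩, hy.le, le_rfl⟩
    exact ⟨⟨h1.1.1, h2.1.2⟩, h1.2.1, h2.2.2⟩
  · rintro ⟨⟨h1, h2⟩, h3, h4⟩ p ⟨⟨a, b⟩, c, d⟩
    exact ⟨⟨h1.trans a, b.trans h2⟩, h3.trans c, d.trans h4⟩

theorem disjoint_inner_iff {a b : Rect} :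
    Disjoint a.inner b.inner ↔ (a.x₂ ≤ b.x₁ ∨ b.x₂ ≤ a.x₁) ∨ a.y₂ ≤ b.y₁ ∨ b.y₂ ≤ a.y₁ := by
  have := a.hx
  have := a.hy
  have := b.hx
  have := b.hy
  simp only [inner, Set.disjoint_prod, Set.Ioo_disjoint_Ioo, min_le_iff, le_max_iff]
  constructor
  · rintro (((h | h) | (h | h)) | ((h | h) | (h | h))) <;>
      first
      | exact absurd h (by linarith)
      | simp only [h, true_or, or_true]
  · rintro ((h | h) | (h | h)) <;> simp only [h, true_or, or_true]

theorem edge_subset_region (r : Rect) (d : Side) : r.edge d ⊆ r.region := by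
  have hx := r.hx.le
  have hy := r.hy.le
  cases d
  · rintro p ⟨h, h'⟩
    rw [Set.mem_singleton_iff] at h
    exact ⟨⟨h.ge, h.trans_le hx⟩, h'⟩
  · rintro p ⟨h, h'⟩
    rw [Set.mem_singleton_iff] at h
    exact ⟨⟨hx.trans h.ge, h.le⟩, h'⟩
  · rintro p ⟨h, h'⟩
    rw [Set.mem_singleton_iff] at h'
    exact ⟨h, h'.ge, h'.trans_le hy⟩
  · rintro p ⟨h, h'⟩
    rw [Set.mem_singleton_iff] at h'
    exact ⟨h, hy.trans h'.ge, h'.le⟩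

theorem edge_disjoint_inner (r : Rect) (d : Side) {p : ℝ × ℝ} (hp : p ∈ r.edge d) :
    p ∉ r.inner := by
  rintro ⟨⟨h1, h2⟩, h3, h4⟩
  cases d
  · exact h1.ne' hp.1
  · exact h2.ne hp.1
  · exact h3.ne' hp.2
  · exact h4.ne hp.2

theorem eq_of_coord {a b : Rect} (h : ∀ d, a.coord d = b.coord d) : a = b := by
  have h1 := h Side.left
  have h2 := h Side.right
  have h3 := h Side.bottom
  have h4 := h Side.top
  cases a
  cases b
  simp only [coord] at h1 h2 h3 h4
  subst h1 h2 h3 h4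
  rfl

end Rect

/-! ### Maximal segments of a drawing. -/

theorem edge_subset_drawing {D : Finset Rect} {a : Rect} (ha : a ∈ D) (d : Side) :
    a.edge d ⊆ drawing D := fun _ hp =>
  Set.mem_iUnion₂.2 ⟨a, ha, Set.mem_iUnion.2 ⟨d, hp⟩⟩

theorem isCompact_drawing (D : Finset Rect) : IsCompact (drawing D) := by
  have : Finite Side := Finite.of_surjective
    (fun i : Fin 4 => ![Side.left, Side.right, Side.bottom, Side.top] i) (by
      intro d
      cases d
      exacts [⟨0, rfl⟩, ⟨1, rfl⟩, ⟨2, rfl⟩, ⟨3, rfl⟩])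
  refine D.isCompact_biUnion fun r _ => isCompact_iUnion fun d => ?_
  cases d
  · exact isCompact_singleton.prod isCompact_Icc
  · exact isCompact_singleton.prod isCompact_Icc
  · exact isCompact_Icc.prod isCompact_singleton
  · exact isCompact_Icc.prod isCompact_singleton

section Segments

variable {D : Finset Rect} {s t : Set (ℝ × ℝ)} {x y a b : ℝ}

theorem IsAxisSegment.eq_vertical (ht : IsAxisSegment t) (hab : a < b)
    (h : {x} ×ˢ Set.Icc a b ⊆ t) : ∃ p q, p ≤ a ∧ b ≤ q ∧ t = {x} ×ˢ Set.Icc p q := by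
  have h1 := @h (x, a) ⟨rfl, le_rfl, hab.le⟩
  have h2 := @h (x, b) ⟨rfl, hab.le, le_rfl⟩
  obtain ⟨z, p, q, -, rfl⟩ | ⟨p, q, z, -, rfl⟩ := ht
  · obtain rfl : x = z := h1.1
    exact ⟨p, q, h1.2.1, h2.2.2, rfl⟩
  · exact absurd (h1.2.trans (Eq.symm h2.2)) hab.ne

theorem IsAxisSegment.eq_horizontal (ht : IsAxisSegment t) (hab : a < b)
    (h : Set.Icc a b ×ˢ {y} ⊆ t) : ∃ p q, p ≤ a ∧ b ≤ q ∧ t = Set.Icc p q ×ˢ {y} := by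
  have h1 := @h (a, y) ⟨⟨le_rfl, hab.le⟩, rfl⟩
  have h2 := @h (b, y) ⟨⟨hab.le, le_rfl⟩, rfl⟩
  obtain ⟨z, p, q, -, rfl⟩ | ⟨p, q, z, -, rfl⟩ := ht
  · exact absurd (h1.1.trans (Eq.symm h2.1)) hab.ne
  · obtain rfl : y = z := h1.2
    exact ⟨p, q, h1.1.1, h2.1.2, rfl⟩

/-- An interval in a compact set of reals lies in a largest such interval. -/
theorem exists_maximal_Icc {S : Set ℝ} (hS : IsCompact S) (hab : a ≤ b)
    (h : Set.Icc a b ⊆ S) :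
    ∃ p q, p ≤ a ∧ b ≤ q ∧ Set.Icc p q ⊆ S ∧
      ∀ p' q', p' ≤ a → b ≤ q' → Set.Icc p' q' ⊆ S → p ≤ p' ∧ q' ≤ q := by
  have ha : a ∈ S := h ⟨le_rfl, hab⟩
  -- The largest interval is the connected component of `a` in `S`: compact and connected, hence a
  -- closed interval.
  have hc : IsCompact (connectedComponentIn S a) := by
    have : CompactSpace S := isCompact_iff_compactSpace.1 hS
    rw [connectedComponentIn_eq_image ha]
    exact isClosed_connectedComponent.isCompact.image continuous_subtype_val
  have hcon : IsConnected (connectedComponentIn S a) := isConnected_connectedComponentIn_iff.2 ha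
  have hmax : ∀ p' q', p' ≤ a → b ≤ q' → Set.Icc p' q' ⊆ S →
      Set.Icc p' q' ⊆ connectedComponentIn S a := fun p' q' hp hq hs =>
    isPreconnected_Icc.subset_connectedComponentIn ⟨hp, hab.trans hq⟩ hs
  have heq := eq_Icc_of_connected_compact hcon hc
  set p := sInf (connectedComponentIn S a)
  set q := sSup (connectedComponentIn S a)
  rw [heq] at hmax
  have h0 := hmax a b le_rfl le_rfl h
  refine ⟨p, q, (h0 ⟨le_rfl, hab⟩).1, (h0 ⟨hab, le_rfl⟩).2,
    heq ▸ connectedComponentIn_subset S a, fun p' q' hp hq hs => ?_⟩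
  have h1 := hmax p' q' hp hq hs
  have hpq : p' ≤ q' := hp.trans (hab.trans hq)
  exact ⟨(h1 ⟨le_rfl, hpq⟩).1, (h1 ⟨hpq, le_rfl⟩).2⟩

/-- The slice of the compact drawing by the line is compact, so the interval extends to a largest
one in it. Any axis segment containing a nondegenerate vertical one lies on the same line, so
maximality within the slice suffices. -/
theorem exists_isSegment_of_vertical (hab : a < b) (h : {x} ×ˢ Set.Icc a b ⊆ drawing D) :
    ∃ s, IsSegment D s ∧ {x} ×ˢ Set.Icc a b ⊆ s := by
  have hS : IsCompact ((fun y : ℝ => (x, y)) ⁻¹' drawing D) :=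
    (Topology.IsClosedEmbedding.of_continuous_injective_isClosedMap (by fun_prop)
      (Prod.mk_right_injective x) (isClosedMap_prodMk_left x)).isCompact_preimage
      (isCompact_drawing D)
  obtain ⟨p, q, hp, hq, hs, hmax⟩ := exists_maximal_Icc hS hab.le
    (fun y hy => h ⟨rfl, hy⟩)
  refine ⟨{x} ×ˢ Set.Icc p q, ⟨⟨.inl ⟨x, p, q, by linarith, rfl⟩, ?_⟩, ?_⟩,
    Set.prod_mono_right (Set.Icc_subset_Icc hp hq)⟩
  · rintro ⟨z, y⟩ ⟨hz, hy⟩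
    obtain rfl : z = x := hz
    exact hs hy
  · rintro t ⟨ht, htD⟩ hst
    obtain ⟨p', q', hp', hq', rfl⟩ := ht.eq_vertical (by linarith) hst
    obtain ⟨h1, h2⟩ := hmax p' q' (hp'.trans hp) (hq.trans hq') (fun y hy => htD ⟨rfl, hy⟩)
    exact Set.prod_mono_right (Set.Icc_subset_Icc h1 h2)

theorem exists_isSegment_of_horizontal (hab : a < b) (h : Set.Icc a b ×ˢ {y} ⊆ drawing D) :
    ∃ s, IsSegment D s ∧ Set.Icc a b ×ˢ {y} ⊆ s := by
  have hS : IsCompact ((fun x : ℝ => (x, y)) ⁻¹' drawing D) :=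
    (Topology.IsClosedEmbedding.of_continuous_injective_isClosedMap (by fun_prop)
      (Prod.mk_left_injective y) (isClosedMap_prodMk_right y)).isCompact_preimage
      (isCompact_drawing D)
  obtain ⟨p, q, hp, hq, hs, hmax⟩ := exists_maximal_Icc hS hab.le
    (fun x hx => h ⟨hx, rfl⟩)
  refine ⟨Set.Icc p q ×ˢ {y}, ⟨⟨.inr ⟨p, q, y, by linarith, rfl⟩, ?_⟩, ?_⟩,
    Set.prod_mono_left (Set.Icc_subset_Icc hp hq)⟩
  · rintro ⟨x, z⟩ ⟨hx, hz⟩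
    obtain rfl : z = y := hz
    exact hs hx
  · rintro t ⟨ht, htD⟩ hst
    obtain ⟨p', q', hp', hq', rfl⟩ := ht.eq_horizontal (by linarith) hst
    obtain ⟨h1, h2⟩ := hmax p' q' (hp'.trans hp) (hq.trans hq') (fun x hx => htD ⟨hx, rfl⟩)
    exact Set.prod_mono_left (Set.Icc_subset_Icc h1 h2)

end Segments

/-! ### Rooms supported by a common segment. -/

/-- One segment contains the edge of `a` on the side `d` and the edge of `b` on the side `e`. -/
def Shares (D : Finset Rect) (d e : Side) (a b : Rect) : Prop :=
  ∃ s, IsSegment D s ∧ SegRoom d s a ∧ SegRoom e s b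

/-- The edges of `a` on the side `d` and of `b` on the side `e` are collinear and meet. -/
def Touch (d e : Side) (a b : Rect) : Prop :=
  a.coord d = b.coord e ∧ a.lo d ≤ b.hi e ∧ b.lo e ≤ a.hi d

theorem Rect.lo_lt_hi (r : Rect) (d : Side) : r.lo d < r.hi d := by
  cases d
  exacts [r.hy, r.hy, r.hx, r.hx]

theorem Rect.edge_vertical {r : Rect} {d : Side} (hd : d = Side.left ∨ d = Side.right) :
    r.edge d = {r.coord d} ×ˢ Set.Icc (r.lo d) (r.hi d) := by
  rcases hd with rfl | rfl <;> rfl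

theorem Rect.edge_horizontal {r : Rect} {d : Side} (hd : d = Side.bottom ∨ d = Side.top) :
    r.edge d = Set.Icc (r.lo d) (r.hi d) ×ˢ {r.coord d} := by
  rcases hd with rfl | rfl <;> rfl

theorem Side.vertical_or_horizontal {d e : Side} (he : e = d ∨ e = d.opp) :
    ((d = left ∨ d = right) ∧ (e = left ∨ e = right)) ∨
      ((d = bottom ∨ d = top) ∧ (e = bottom ∨ e = top)) := by
  cases d <;> rcases he with rfl | rfl <;> simp [Side.opp]

/-- The two edges unite to one drawn interval, which extends to a maximal segment. Sharing thus
follows from coordinate inequalities, without determining the segments of the dissection. -/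
theorem Touch.shares {D : Finset Rect} {d e : Side} {a b : Rect} (h : Touch d e a b)
    (he : e = d ∨ e = d.opp) (ha : a ∈ D) (hb : b ∈ D) : Shares D d e a b := by
  obtain ⟨hc, h1, h2⟩ := h
  have hal := a.lo_lt_hi d
  have hbl := b.lo_lt_hi e
  have hun : Set.Icc (a.lo d) (a.hi d) ∪ Set.Icc (b.lo e) (b.hi e) =
      Set.Icc (min (a.lo d) (b.lo e)) (max (a.hi d) (b.hi e)) :=
    Set.Icc_union_Icc' h2 h1
  have hlt : min (a.lo d) (b.lo e) < max (a.hi d) (b.hi e) :=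
    (min_le_left _ _).trans_lt (hal.trans_le (le_max_left _ _))
  have hA := edge_subset_drawing ha d
  have hB := edge_subset_drawing hb e
  rcases Side.vertical_or_horizontal he with ⟨hd, he⟩ | ⟨hd, he⟩
  · rw [Rect.edge_vertical hd] at hA
    rw [Rect.edge_vertical he, ← hc] at hB
    obtain ⟨s, hs, hsub⟩ := exists_isSegment_of_vertical (x := a.coord d) hlt (by
      rw [← hun, Set.prod_union]; exact Set.union_subset hA hB)
    rw [← hun, Set.prod_union] at hsub
    refine ⟨s, hs, ?_, ?_⟩
    · rw [SegRoom, Rect.edge_vertical hd]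
      exact Set.subset_union_left.trans hsub
    · rw [SegRoom, Rect.edge_vertical he, ← hc]
      exact Set.subset_union_right.trans hsub
  · rw [Rect.edge_horizontal hd] at hA
    rw [Rect.edge_horizontal he, ← hc] at hB
    obtain ⟨s, hs, hsub⟩ := exists_isSegment_of_horizontal (y := a.coord d) hlt (by
      rw [← hun, Set.union_prod]; exact Set.union_subset hA hB)
    rw [← hun, Set.union_prod] at hsub
    refine ⟨s, hs, ?_, ?_⟩
    · rw [SegRoom, Rect.edge_horizontal hd]
      exact Set.subset_union_left.trans hsub
    · rw [SegRoom, Rect.edge_horizontal he, ← hc]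
      exact Set.subset_union_right.trans hsub

theorem Shares.coord_eq {D : Finset Rect} {d e : Side} {a b : Rect} (h : Shares D d e a b)
    (he : e = d ∨ e = d.opp) : a.coord d = b.coord e := by
  obtain ⟨s, hs, hA, hB⟩ := h
  have hal := a.lo_lt_hi d
  have hbl := b.lo_lt_hi e
  rcases Side.vertical_or_horizontal he with ⟨hd, he⟩ | ⟨hd, he⟩
  · rw [SegRoom, Rect.edge_vertical hd] at hA
    rw [SegRoom, Rect.edge_vertical he] at hB
    obtain ⟨p, q, -, -, rfl⟩ := hs.prop.1.eq_vertical hal hA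
    exact Eq.symm (@hB (b.coord e, b.lo e) ⟨rfl, le_rfl, hbl.le⟩).1
  · rw [SegRoom, Rect.edge_horizontal hd] at hA
    rw [SegRoom, Rect.edge_horizontal he] at hB
    obtain ⟨p, q, -, -, rfl⟩ := hs.prop.1.eq_horizontal hal hA
    exact Eq.symm (@hB (b.lo e, b.coord e) ⟨⟨le_rfl, hbl.le⟩, rfl⟩).2

/-! ### Crossing lines and blocks in a mosaic dissection. -/

section Dissection

variable {R : Rect} {D : Finset Rect}

theorem IsDissection.region_subset (h : IsDissection R D) {a : Rect} (ha : a ∈ D) :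
    a.region ⊆ R.region := by
  rw [← h.1]
  exact fun p hp => Set.mem_iUnion₂.2 ⟨a, ha, hp⟩

theorem eq_of_mem_inner_of_mem_region
    (hD : ∀ r ∈ D, ∀ s ∈ D, r ≠ s → Disjoint r.inner s.inner) {a b : Rect}
    (ha : a ∈ D) (hb : b ∈ D) {p : ℝ × ℝ} (hpa : p ∈ a.inner) (hpb : p ∈ b.region) : a = b := by
  by_contra hne
  obtain ⟨⟨h1, h2⟩, h3, h4⟩ := hpa
  obtain ⟨⟨h5, h6⟩, h7, h8⟩ := hpb
  rcases Rect.disjoint_inner_iff.1 (hD a ha b hb hne) with (h | h) | (h | h) <;> linarith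

theorem IsDissection.drawing_subset (h : IsDissection R D) : drawing D ⊆ R.region := by
  intro p hp
  obtain ⟨a, ha, hp⟩ := Set.mem_iUnion₂.1 hp
  obtain ⟨d, hp⟩ := Set.mem_iUnion.1 hp
  exact h.region_subset ha (a.edge_subset_region d hp)

theorem IsDissection.notMem_inner_of_mem_drawing (h : IsDissection R D) {p : ℝ × ℝ}
    (hp : p ∈ drawing D) {a : Rect} (ha : a ∈ D) : p ∉ a.inner := by
  intro hpa
  obtain ⟨b, hb, hp⟩ := Set.mem_iUnion₂.1 hp
  obtain ⟨d, hp⟩ := Set.mem_iUnion.1 hp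
  obtain rfl := eq_of_mem_inner_of_mem_region h.2 ha hb hpa (b.edge_subset_region d hp)
  exact a.edge_disjoint_inner d hp hpa

open Filter Topology in
/-- Some room contains points arbitrarily close to `(x, y)` in the direction `(σ, τ)`. -/
theorem IsDissection.exists_room_frequently (h : IsDissection R D) {x y ε σ τ : ℝ} (hε : 0 < ε)
    (hR : ∀ δ, 0 < δ → δ < ε → (x + σ * δ, y + τ * δ) ∈ R.region) :
    ∃ a ∈ D, ∀ η > 0, ∃ δ, 0 < δ ∧ δ < η ∧ (x + σ * δ, y + τ * δ) ∈ a.region := by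
  by_contra! hcon
  have h1 : ∀ a ∈ D, ∀ᶠ δ in 𝓝[>] (0 : ℝ), (x + σ * δ, y + τ * δ) ∉ a.region := by
    intro a ha
    obtain ⟨η, hη, h⟩ := hcon a ha
    filter_upwards [Ioo_mem_nhdsGT hη] with δ hδ using h δ hδ.1 hδ.2
  -- There are finitely many rooms, so if each avoids the ray near its origin, all do so together,
  -- although they cover it.
  have h2 : ∀ᶠ δ in 𝓝[>] (0 : ℝ), False := by
    filter_upwards [(eventually_all_finset D).2 h1, Ioo_mem_nhdsGT hε] with δ hδ hδ'
    have h3 := hR δ hδ'.1 hδ'.2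
    rw [← h.1] at h3
    obtain ⟨a, ha, hp⟩ := Set.mem_iUnion₂.1 h3
    exact hδ a ha hp
  exact h2.exists.elim fun _ => id

/-- Where a horizontal and a vertical line of the drawing cross, four rooms meet. -/
theorem IsDissection.isCrossJunction (h : IsDissection R D) {x y ε : ℝ} (hε : 0 < ε)
    (hR₁ : (x - ε, y - ε) ∈ R.region) (hR₂ : (x + ε, y + ε) ∈ R.region)
    (hv : {x} ×ˢ Set.Icc (y - ε) (y + ε) ⊆ drawing D)
    (hh : Set.Icc (x - ε) (x + ε) ×ˢ {y} ⊆ drawing D) : IsCrossJunction D (x, y) := by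
  obtain ⟨⟨r1, r2⟩, r3, r4⟩ := hR₁
  obtain ⟨⟨r5, r6⟩, r7, r8⟩ := hR₂
  dsimp only at r1 r2 r3 r4 r5 r6 r7 r8
  -- A drawn line meets no open room, so no room near the crossing straddles either line.
  have hv' : ∀ a ∈ D, a.y₁ < y + ε → y - ε < a.y₂ → a.x₁ < x → x < a.x₂ → False := by
    intro a ha h1 h2 h3 h4
    have hlt : max a.y₁ (y - ε) < min a.y₂ (y + ε) := by
      have := a.hy
      simp only [max_lt_iff, lt_min_iff]
      exact ⟨⟨by linarith, by linarith⟩, by linarith, by linarith⟩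
    obtain ⟨t, ht1, ht2⟩ := exists_between hlt
    rw [max_lt_iff] at ht1
    rw [lt_min_iff] at ht2
    exact h.notMem_inner_of_mem_drawing (@hv (x, t) ⟨rfl, ht1.2.le, ht2.2.le⟩) ha
      ⟨⟨h3, h4⟩, ht1.1, ht2.1⟩
  have hh' : ∀ a ∈ D, a.x₁ < x + ε → x - ε < a.x₂ → a.y₁ < y → y < a.y₂ → False := by
    intro a ha h1 h2 h3 h4
    have hlt : max a.x₁ (x - ε) < min a.x₂ (x + ε) := by
      have := a.hx
      simp only [max_lt_iff, lt_min_iff]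
      exact ⟨⟨by linarith, by linarith⟩, by linarith, by linarith⟩
    obtain ⟨t, ht1, ht2⟩ := exists_between hlt
    rw [max_lt_iff] at ht1
    rw [lt_min_iff] at ht2
    exact h.notMem_inner_of_mem_drawing (@hh (t, y) ⟨⟨ht1.2.le, ht2.2.le⟩, rfl⟩) ha
      ⟨⟨ht1.1, ht2.1⟩, h3, h4⟩
  -- In each quadrant some room accumulates at the crossing along the diagonal. It straddles neither
  -- line, so its corner is the crossing itself.
  have hex : ∀ σ τ : ℝ, (σ = 1 ∨ σ = -1) → (τ = 1 ∨ τ = -1) → ∃ a ∈ D,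
      (σ = 1 → a.x₁ = x) ∧ (σ = -1 → a.x₂ = x) ∧ (τ = 1 → a.y₁ = y) ∧ (τ = -1 → a.y₂ = y) := by
    intro σ τ hσ hτ
    obtain ⟨a, ha, hfr⟩ := h.exists_room_frequently (x := x) (y := y) (σ := σ) (τ := τ) hε (by
      intro δ h0 h1
      rcases hσ with rfl | rfl <;> rcases hτ with rfl | rfl <;>
        exact ⟨⟨by dsimp only; linarith, by dsimp only; linarith⟩,
          by dsimp only; linarith, by dsimp only; linarith⟩)
    obtain ⟨δ, h0, h1, ⟨h2, h3⟩, h4, h5⟩ := hfr ε hε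
    dsimp only at h2 h3 h4 h5
    have near : ∀ η > 0, ∃ δ, 0 < δ ∧ δ < η ∧ (a.x₁ ≤ x + σ * δ ∧ x + σ * δ ≤ a.x₂) ∧
      a.y₁ ≤ y + τ * δ ∧ y + τ * δ ≤ a.y₂ := hfr
    have hx1 : a.x₁ < x + ε := by rcases hσ with rfl | rfl <;> linarith
    have hx2 : x - ε < a.x₂ := by rcases hσ with rfl | rfl <;> linarith
    have hy1 : a.y₁ < y + ε := by rcases hτ with rfl | rfl <;> linarith
    have hy2 : y - ε < a.y₂ := by rcases hτ with rfl | rfl <;> linarith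
    have hv'' := hv' a ha hy1 hy2
    have hh'' := hh' a ha hx1 hx2
    refine ⟨a, ha, ?_, ?_, ?_, ?_⟩
    · rintro rfl
      refine le_antisymm (not_lt.1 fun hlt => ?_) (not_lt.1 fun hlt => hv'' hlt (by linarith))
      obtain ⟨δ, h0, h1, ⟨h2, h3⟩, -⟩ := near _ (sub_pos.2 hlt)
      linarith
    · rintro rfl
      refine le_antisymm (not_lt.1 fun hlt => hv'' (by linarith) hlt) (not_lt.1 fun hlt => ?_)
      obtain ⟨δ, h0, h1, ⟨h2, h3⟩, -⟩ := near _ (sub_pos.2 hlt)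
      linarith
    · rintro rfl
      refine le_antisymm (not_lt.1 fun hlt => ?_) (not_lt.1 fun hlt => hh'' hlt (by linarith))
      obtain ⟨δ, h0, h1, -, h2, h3⟩ := near _ (sub_pos.2 hlt)
      linarith
    · rintro rfl
      refine le_antisymm (not_lt.1 fun hlt => hh'' (by linarith) hlt) (not_lt.1 fun hlt => ?_)
      obtain ⟨δ, h0, h1, -, h2, h3⟩ := near _ (sub_pos.2 hlt)
      linarith
  obtain ⟨a, ha, -, ha1, -, ha2⟩ := hex (-1) (-1) (.inr rfl) (.inr rfl)
  obtain ⟨b, hb, hb1, -, -, hb2⟩ := hex 1 (-1) (.inl rfl) (.inr rfl)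
  obtain ⟨c, hc, -, hc1, hc2, -⟩ := hex (-1) 1 (.inr rfl) (.inl rfl)
  obtain ⟨d, hd, hd1, -, hd2, -⟩ := hex 1 1 (.inl rfl) (.inl rfl)
  exact ⟨a, ha, b, hb, c, hc, d, hd, by rw [ha1 rfl, ha2 rfl], by rw [hb1 rfl, hb2 rfl],
    by rw [hc1 rfl, hc2 rfl], by rw [hd1 rfl, hd2 rfl]⟩

/-- The rooms in `B` form a block of `D` with union the rectangle `r`. -/
structure IsBlock (D : Finset Rect) (r : Rect) (B : Finset Rect) : Prop where
  subset : B ⊆ D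
  union : (⋃ b ∈ B, b.region) = r.region

namespace IsBlock

variable {r : Rect} {B : Finset Rect}

theorem region_subset (h : IsBlock D r B) {b : Rect} (hb : b ∈ B) : b.region ⊆ r.region := by
  rw [← h.union]
  exact fun p hp => Set.mem_iUnion₂.2 ⟨b, hb, hp⟩

theorem bounds (h : IsBlock D r B) {b : Rect} (hb : b ∈ B) :
    (r.x₁ ≤ b.x₁ ∧ b.x₂ ≤ r.x₂) ∧ r.y₁ ≤ b.y₁ ∧ b.y₂ ≤ r.y₂ :=
  Rect.region_subset_iff.1 (h.region_subset hb)

theorem exists_mem (h : IsBlock D r B) {p : ℝ × ℝ} (hp : p ∈ r.region) :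
    ∃ b ∈ B, p ∈ b.region := by
  rw [← h.union] at hp
  simpa using hp

/-- The frame of a block is drawn. -/
theorem edge_subset_drawing (h : IsBlock D r B) (d : Side) : r.edge d ⊆ drawing D := by
  intro p hp
  obtain ⟨b, hb, hpb⟩ := h.exists_mem (r.edge_subset_region d hp)
  obtain ⟨⟨h1, h2⟩, h3, h4⟩ := h.bounds hb
  obtain ⟨⟨h5, h6⟩, h7, h8⟩ := hpb
  refine Floorplan.edge_subset_drawing (h.subset hb) d ?_
  cases d
  · obtain ⟨e, -⟩ := hp
    rw [Set.mem_singleton_iff] at e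
    exact ⟨le_antisymm (by linarith) h5, h7, h8⟩
  · obtain ⟨e, -⟩ := hp
    rw [Set.mem_singleton_iff] at e
    exact ⟨le_antisymm h6 (by linarith), h7, h8⟩
  · obtain ⟨-, e⟩ := hp
    rw [Set.mem_singleton_iff] at e
    exact ⟨⟨h5, h6⟩, le_antisymm (by linarith) h7⟩
  · obtain ⟨-, e⟩ := hp
    rw [Set.mem_singleton_iff] at e
    exact ⟨⟨h5, h6⟩, le_antisymm h8 (by linarith)⟩

/-- A common interior point of `c` and `r` is covered by a room of the block, and interiors of
distinct rooms are disjoint. -/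
theorem mem_of_overlap (h : IsBlock D r B) (hD : IsDissection R D) {c : Rect} (hc : c ∈ D)
    (hcr : ¬ Disjoint c.inner r.inner) : c ∈ B := by
  obtain ⟨p, hpc, hpr⟩ := Set.not_disjoint_iff.1 hcr
  obtain ⟨b, hb, hpb⟩ := h.exists_mem
    (p := p) ⟨⟨hpr.1.1.le, hpr.1.2.le⟩, hpr.2.1.le, hpr.2.2.le⟩
  rwa [eq_of_mem_inner_of_mem_region hD.2 hc (h.subset hb) hpc hpb]

theorem frame_bounds (h : IsBlock D r B) (hD : IsDissection R D) :
    (R.x₁ ≤ r.x₁ ∧ r.x₂ ≤ R.x₂) ∧ R.y₁ ≤ r.y₁ ∧ r.y₂ ≤ R.y₂ := by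
  rw [← Rect.region_subset_iff, ← h.union]
  exact Set.iUnion₂_subset fun b hb => hD.region_subset (h.subset hb)

/-- A vertical line of the drawing does not cross the frame of a block. -/
theorem vertical_bounds (h : IsBlock D r B) (hD : IsMosaic R D) {x p q a b : ℝ}
    (hx₁ : r.x₁ < x) (hx₂ : x < r.x₂) (hs : {x} ×ˢ Set.Icc p q ⊆ drawing D)
    (hpa : p ≤ a) (hab : a < b) (hbq : b ≤ q) (ha : r.y₁ ≤ a) (hb : b ≤ r.y₂) :
    r.y₁ ≤ p ∧ q ≤ r.y₂ := by
  obtain ⟨⟨h1, h2⟩, h3, h4⟩ := h.frame_bounds hD.1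
  obtain ⟨-, h5, -⟩ := hD.1.drawing_subset (@hs (x, p) ⟨rfl, le_rfl, by linarith⟩)
  obtain ⟨-, -, h6⟩ := hD.1.drawing_subset (@hs (x, q) ⟨rfl, by linarith, le_rfl⟩)
  dsimp only at h5 h6
  constructor <;> by_contra! hlt
  -- If the line sticks out below, it crosses the bottom of the frame at `(x, r.y₁)`. An `ε` below
  -- all four distances keeps both arms drawn and the small square inside `R`, which gives a
  -- forbidden cross junction.
  · obtain ⟨ε, hε, hle⟩ := exists_between (show 0 < min (min (x - r.x₁) (r.x₂ - x))
      (min (r.y₁ - p) (q - r.y₁)) by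
        simp only [lt_min_iff, sub_pos]; exact ⟨⟨hx₁, hx₂⟩, hlt, by linarith⟩)
    simp only [lt_min_iff] at hle
    refine hD.2 _ (hD.1.isCrossJunction (x := x) (y := r.y₁) hε
      ⟨⟨by dsimp only; linarith, by dsimp only; linarith⟩,
        by dsimp only; linarith, by dsimp only; linarith⟩
      ⟨⟨by dsimp only; linarith, by dsimp only; linarith⟩,
        by dsimp only; linarith, by dsimp only; linarith⟩
      ((Set.prod_mono_right (Set.Icc_subset_Icc (by linarith) (by linarith))).trans hs)
      ((Set.prod_mono_left (Set.Icc_subset_Icc (by linarith) (by linarith))).trans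
        (h.edge_subset_drawing Side.bottom)))
  · obtain ⟨ε, hε, hle⟩ := exists_between (show 0 < min (min (x - r.x₁) (r.x₂ - x))
      (min (r.y₂ - p) (q - r.y₂)) by
        simp only [lt_min_iff, sub_pos]; exact ⟨⟨hx₁, hx₂⟩, by linarith, hlt⟩)
    simp only [lt_min_iff] at hle
    refine hD.2 _ (hD.1.isCrossJunction (x := x) (y := r.y₂) hε
      ⟨⟨by dsimp only; linarith, by dsimp only; linarith⟩,
        by dsimp only; linarith, by dsimp only; linarith⟩
      ⟨⟨by dsimp only; linarith, by dsimp only; linarith⟩,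
        by dsimp only; linarith, by dsimp only; linarith⟩
      ((Set.prod_mono_right (Set.Icc_subset_Icc (by linarith) (by linarith))).trans hs)
      ((Set.prod_mono_left (Set.Icc_subset_Icc (by linarith) (by linarith))).trans
        (h.edge_subset_drawing Side.top)))

/-- A horizontal line of the drawing does not cross the frame of a block. -/
theorem horizontal_bounds (h : IsBlock D r B) (hD : IsMosaic R D) {y p q a b : ℝ}
    (hy₁ : r.y₁ < y) (hy₂ : y < r.y₂) (hs : Set.Icc p q ×ˢ {y} ⊆ drawing D)
    (hpa : p ≤ a) (hab : a < b) (hbq : b ≤ q) (ha : r.x₁ ≤ a) (hb : b ≤ r.x₂) :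
    r.x₁ ≤ p ∧ q ≤ r.x₂ := by
  obtain ⟨⟨h1, h2⟩, h3, h4⟩ := h.frame_bounds hD.1
  obtain ⟨⟨h5, -⟩, -⟩ := hD.1.drawing_subset (@hs (p, y) ⟨⟨le_rfl, by linarith⟩, rfl⟩)
  obtain ⟨⟨-, h6⟩, -⟩ := hD.1.drawing_subset (@hs (q, y) ⟨⟨by linarith, le_rfl⟩, rfl⟩)
  dsimp only at h5 h6
  constructor <;> by_contra! hlt
  · obtain ⟨ε, hε, hle⟩ := exists_between (show 0 < min (min (y - r.y₁) (r.y₂ - y))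
      (min (r.x₁ - p) (q - r.x₁)) by
        simp only [lt_min_iff, sub_pos]; exact ⟨⟨hy₁, hy₂⟩, hlt, by linarith⟩)
    simp only [lt_min_iff] at hle
    refine hD.2 _ (hD.1.isCrossJunction (x := r.x₁) (y := y) hε
      ⟨⟨by dsimp only; linarith, by dsimp only; linarith⟩,
        by dsimp only; linarith, by dsimp only; linarith⟩
      ⟨⟨by dsimp only; linarith, by dsimp only; linarith⟩,
        by dsimp only; linarith, by dsimp only; linarith⟩
      ((Set.prod_mono_right (Set.Icc_subset_Icc (by linarith) (by linarith))).trans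
        (h.edge_subset_drawing Side.left))
      ((Set.prod_mono_left (Set.Icc_subset_Icc (by linarith) (by linarith))).trans hs))
  · obtain ⟨ε, hε, hle⟩ := exists_between (show 0 < min (min (y - r.y₁) (r.y₂ - y))
      (min (r.x₂ - p) (q - r.x₂)) by
        simp only [lt_min_iff, sub_pos]; exact ⟨⟨hy₁, hy₂⟩, by linarith, hlt⟩)
    simp only [lt_min_iff] at hle
    refine hD.2 _ (hD.1.isCrossJunction (x := r.x₂) (y := y) hε
      ⟨⟨by dsimp only; linarith, by dsimp only; linarith⟩,
        by dsimp only; linarith, by dsimp only; linarith⟩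
      ⟨⟨by dsimp only; linarith, by dsimp only; linarith⟩,
        by dsimp only; linarith, by dsimp only; linarith⟩
      ((Set.prod_mono_right (Set.Icc_subset_Icc (by linarith) (by linarith))).trans
        (h.edge_subset_drawing Side.right))
      ((Set.prod_mono_left (Set.Icc_subset_Icc (by linarith) (by linarith))).trans hs))

end IsBlock

end Dissection
-- The combinatorial trace of a block.
/-- Every room on either side of the segment through the edge of `a` on the side `d` is in `B`. -/
def Internal (D B : Finset Rect) (d : Side) (a : Rect) : Prop :=
  ∀ c ∈ D, ∀ e, (e = d ∨ e = d.opp) → Shares D d e a c → c ∈ B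

/-- The combinatorial properties of a block, in terms of the segments shared by rooms. -/
structure Interlocked (D B : Finset Rect) : Prop where
  subset : B ⊆ D
  internal_of_opp : ∀ d, ∀ a ∈ B, ∀ b ∈ B, Shares D d d.opp a b → Internal D B d a
  internal_or : ∀ d, ∀ a ∈ B, ∀ b ∈ B, ¬ Shares D d d a b →
    Internal D B d a ∨ Internal D B d b

namespace IsBlock

variable {R r : Rect} {D B : Finset Rect}

/-- An edge off the corresponding frame line lies strictly between opposite sides of the frame. Its
segment cannot cross the frame, so every room resting on it overlaps the interior of `r`. -/
theorem internal_of_coord_ne (h : IsBlock D r B) (hD : IsMosaic R D) {a : Rect} (ha : a ∈ B)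
    {d : Side} (hne : a.coord d ≠ r.coord d) : Internal D B d a := by
  rintro c hc e he ⟨s, hs, hsa, hsc⟩
  have hce := Shares.coord_eq ⟨s, hs, hsa, hsc⟩ he
  obtain ⟨⟨h1, h2⟩, h3, h4⟩ := h.bounds ha
  have hax := a.hx
  have hay := a.hy
  have hcx := c.hx
  have hcy := c.hy
  refine h.mem_of_overlap hD.1 hc ?_
  rw [Rect.disjoint_inner_iff]
  rcases Side.vertical_or_horizontal he with ⟨hd, he⟩ | ⟨hd, he⟩
  · rw [SegRoom, Rect.edge_vertical hd] at hsa
    rw [SegRoom, Rect.edge_vertical he] at hsc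
    obtain ⟨p, q, hp, hq, rfl⟩ := hs.prop.1.eq_vertical (a.lo_lt_hi d) hsa
    have hx : r.x₁ < a.coord d ∧ a.coord d < r.x₂ := by
      rcases hd with rfl | rfl
      · exact ⟨lt_of_le_of_ne h1 (Ne.symm hne), lt_of_lt_of_le hax h2⟩
      · exact ⟨lt_of_le_of_lt h1 hax, lt_of_le_of_ne h2 hne⟩
    have hlo : a.lo d = a.y₁ := by rcases hd with rfl | rfl <;> rfl
    have hhi : a.hi d = a.y₂ := by rcases hd with rfl | rfl <;> rfl
    rw [hlo] at hp
    rw [hhi] at hq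
    obtain ⟨h5, h6⟩ := h.vertical_bounds hD hx.1 hx.2 hs.prop.2 hp hay hq h3 h4
    have h7 : p ≤ c.y₁ := by
      have := (@hsc (c.coord e, c.lo e) ⟨rfl, le_rfl, (c.lo_lt_hi e).le⟩).2.1
      rcases he with rfl | rfl <;> exact this
    have h8 : c.y₂ ≤ q := by
      have := (@hsc (c.coord e, c.hi e) ⟨rfl, (c.lo_lt_hi e).le, le_rfl⟩).2.2
      rcases he with rfl | rfl <;> exact this
    rw [hce] at hx
    rcases he with rfl | rfl <;> simp only [Rect.coord] at hx <;>
      rintro ((h | h) | (h | h)) <;> linarith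
  · rw [SegRoom, Rect.edge_horizontal hd] at hsa
    rw [SegRoom, Rect.edge_horizontal he] at hsc
    obtain ⟨p, q, hp, hq, rfl⟩ := hs.prop.1.eq_horizontal (a.lo_lt_hi d) hsa
    have hx : r.y₁ < a.coord d ∧ a.coord d < r.y₂ := by
      rcases hd with rfl | rfl
      · exact ⟨lt_of_le_of_ne h3 (Ne.symm hne), lt_of_lt_of_le hay h4⟩
      · exact ⟨lt_of_le_of_lt h3 hay, lt_of_le_of_ne h4 hne⟩
    have hlo : a.lo d = a.x₁ := by rcases hd with rfl | rfl <;> rfl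
    have hhi : a.hi d = a.x₂ := by rcases hd with rfl | rfl <;> rfl
    rw [hlo] at hp
    rw [hhi] at hq
    obtain ⟨h5, h6⟩ := h.horizontal_bounds hD hx.1 hx.2 hs.prop.2 hp hax hq h1 h2
    have h7 : p ≤ c.x₁ := by
      have := (@hsc (c.lo e, c.coord e) ⟨⟨le_rfl, (c.lo_lt_hi e).le⟩, rfl⟩).1.1
      rcases he with rfl | rfl <;> exact this
    have h8 : c.x₂ ≤ q := by
      have := (@hsc (c.hi e, c.coord e) ⟨⟨(c.lo_lt_hi e).le, le_rfl⟩, rfl⟩).1.2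
      rcases he with rfl | rfl <;> exact this
    rw [hce] at hx
    rcases he with rfl | rfl <;> simp only [Rect.coord] at hx <;>
      rintro ((h | h) | (h | h)) <;> linarith

theorem shares_of_coord_eq (h : IsBlock D r B) {a b : Rect} (ha : a ∈ B) (hb : b ∈ B) {d : Side}
    (had : a.coord d = r.coord d) (hbd : b.coord d = r.coord d) : Shares D d d a b := by
  obtain ⟨⟨a1, a2⟩, a3, a4⟩ := h.bounds ha
  obtain ⟨⟨b1, b2⟩, b3, b4⟩ := h.bounds hb
  rcases Side.vertical_or_horizontal (.inl (Eq.refl d)) with ⟨hd, -⟩ | ⟨hd, -⟩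
  · have hr := h.edge_subset_drawing d
    rw [Rect.edge_vertical hd] at hr
    obtain ⟨s, hs, hrs⟩ := exists_isSegment_of_vertical (r.lo_lt_hi d) hr
    refine ⟨s, hs, ?_, ?_⟩
    · rw [SegRoom, Rect.edge_vertical hd, had]
      refine (Set.prod_mono_right (Set.Icc_subset_Icc ?_ ?_)).trans hrs <;>
        rcases hd with rfl | rfl <;> assumption
    · rw [SegRoom, Rect.edge_vertical hd, hbd]
      refine (Set.prod_mono_right (Set.Icc_subset_Icc ?_ ?_)).trans hrs <;>
        rcases hd with rfl | rfl <;> assumption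
  · have hr := h.edge_subset_drawing d
    rw [Rect.edge_horizontal hd] at hr
    obtain ⟨s, hs, hrs⟩ := exists_isSegment_of_horizontal (r.lo_lt_hi d) hr
    refine ⟨s, hs, ?_, ?_⟩
    · rw [SegRoom, Rect.edge_horizontal hd, had]
      refine (Set.prod_mono_left (Set.Icc_subset_Icc ?_ ?_)).trans hrs <;>
        rcases hd with rfl | rfl <;> assumption
    · rw [SegRoom, Rect.edge_horizontal hd, hbd]
      refine (Set.prod_mono_left (Set.Icc_subset_Icc ?_ ?_)).trans hrs <;>
        rcases hd with rfl | rfl <;> assumption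

/-- If `b` lies across the line of an edge of `a`, that line is not on the frame, or `b` would stick
out of `r`. If neither of two edges is internal, both lie on the same side of the frame, which is
part of one segment. -/
theorem interlocked (h : IsBlock D r B) (hD : IsMosaic R D) : Interlocked D B where
  subset := h.subset
  internal_of_opp d a ha b hb hs := by
    refine h.internal_of_coord_ne hD ha fun heq => ?_
    have hc := hs.coord_eq (.inr rfl)
    obtain ⟨⟨h1, h2⟩, h3, h4⟩ := h.bounds hb
    have := b.hx
    have := b.hy
    cases d <;> simp only [Side.opp, Rect.coord] at hc heq <;> linarith
  internal_or d a ha b hb hs := by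
    by_contra! hcon
    exact hs (h.shares_of_coord_eq ha hb
      (by_contra fun hne => hcon.1 (h.internal_of_coord_ne hD ha hne))
      (by_contra fun hne => hcon.2 (h.internal_of_coord_ne hD hb hne)))

end IsBlock

/-! ### Blocks as an obstruction to low hierarchical order. -/

open Classical in
/-- A hierarchical dissection with many rooms has a proper block of at least two rooms. -/
theorem Hierarchical.exists_block {k : ℕ} (hk : 1 ≤ k) {R : Rect} {D : Finset Rect}
    (h : Hierarchical k R D) :
    D.card ≤ k ∨ ∃ r B, IsBlock D r B ∧ 1 < B.card ∧ B ≠ D := by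
  induction h with
  | single => exact .inl (by simpa using hk)
  | embed D E r hD hr hE hcard ih =>
    rcases lt_or_ge 1 E.card with h1 | h1
    -- Either the inserted rooms are the whole dissection, which is then small, or they form a
    -- proper block.
    · by_cases hsub : D.erase r ⊆ E
      · left
        rwa [Finset.union_eq_right.2 hsub]
      · right
        refine ⟨r, E, ⟨Finset.subset_union_right, hE.1.1⟩, h1, fun heq => hsub ?_⟩
        intro x hx
        rw [heq]
        exact Finset.mem_union_left _ hx
    · have hne : E.Nonempty := by
        have hmem : (r.x₁, r.y₁) ∈ r.region := ⟨⟨le_rfl, r.hx.le⟩, le_rfl, r.hy.le⟩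
        rw [← hE.1.1] at hmem
        obtain ⟨a, ha, -⟩ := Set.mem_iUnion₂.1 hmem
        exact ⟨a, ha⟩
      obtain ⟨a, rfl⟩ := Finset.card_eq_one.1 (le_antisymm h1 hne.card_pos)
      -- A replacement by a single room changes nothing, so the induction hypothesis applies.
      have har : a = r := by
        have hreg := hE.1.1
        simp only [Finset.mem_singleton, Set.iUnion_iUnion_eq_left] at hreg
        obtain ⟨⟨h1, h2⟩, h3, h4⟩ := Rect.region_subset_iff.1 hreg.le
        obtain ⟨⟨h5, h6⟩, h7, h8⟩ := Rect.region_subset_iff.1 hreg.ge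
        refine Rect.eq_of_coord fun d => ?_
        cases d
        exacts [le_antisymm h5 h1, le_antisymm h2 h6, le_antisymm h7 h3, le_antisymm h4 h8]
      subst har
      have heq : (D.erase a ∪ {a} : Finset Rect) = D := by
        rw [Finset.union_comm, ← Finset.insert_eq, Finset.insert_erase hr]
      rwa [heq]

theorem Hierarchical.mono {k l : ℕ} (hkl : k ≤ l) {R : Rect} {D : Finset Rect}
    (h : Hierarchical k R D) : Hierarchical l R D := by
  induction h with
  | single => exact .single
  | embed D E r _ hr hE hcard ih => exact .embed D E r ih hr hE (hcard.trans hkl)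

theorem HFO_mono {k l : ℕ} (hkl : k ≤ l) : HFO k ⊆ HFO l := fun _ ⟨f, hf, h⟩ =>
  ⟨f, hf, h.mono hkl⟩

theorem hierarchical_of_isMosaic {k : ℕ} {R : Rect} {D : Finset Rect} (h : IsMosaic R D)
    (hk : D.card ≤ k) : Hierarchical k R D := by
  have := Hierarchical.embed {R} D R .single (Finset.mem_singleton_self R) h hk
  simpa using this

/-- If no proper set of at least two rooms of `f` is interlocked, then `f` is not hierarchical of
any order less than its number of rooms. -/
theorem notMem_HFO {k : ℕ} (hk : 1 ≤ k) (f : MosaicDissection) (hcard : k < f.rooms.card)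
    (hf : ∀ B, Interlocked f.rooms B → 1 < B.card → B = f.rooms) :
    (Quotient.mk mosaicSetoid f : MosaicFloorplan) ∉ HFO k := by
  classical
  rintro ⟨g, hg, hhier⟩
  obtain ⟨φ, ψ, hφ⟩ : Equivalent f g := Quotient.exact hg.symm
  have hc : f.rooms.card = g.rooms.card := by
    rw [← Fintype.card_coe, ← Fintype.card_coe]
    exact Fintype.card_congr φ
  rcases hhier.exists_block hk with h | ⟨r, B, hB, h1, hne⟩
  · omega
  have hI := hB.interlocked g.isMosaic
  -- Sharing a segment is defined by seg-room relations alone, so the bijections preserve it.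
  have hsh : ∀ d e a b, Shares f.rooms d e a.1 b.1 ↔ Shares g.rooms d e (φ a).1 (φ b).1 := by
    intro d e a b
    constructor
    · rintro ⟨s, hs, ha, hb⟩
      exact ⟨(ψ ⟨s, hs⟩).1, (ψ ⟨s, hs⟩).2, (hφ d ⟨s, hs⟩ a).1 ha, (hφ e ⟨s, hs⟩ b).1 hb⟩
    · rintro ⟨s, hs, ha, hb⟩
      refine ⟨(ψ.symm ⟨s, hs⟩).1, (ψ.symm ⟨s, hs⟩).2, ?_, ?_⟩
      · rw [hφ, ψ.apply_symm_apply]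
        exact ha
      · rw [hφ, ψ.apply_symm_apply]
        exact hb
  -- The block of `g` is pulled back to `f`; it will be interlocked there, hence everything, so the
  -- block was not proper.
  set C : Finset Rect := (f.rooms.attach.filter fun a => (φ a).1 ∈ B).image Subtype.val with hC
  have hmem : ∀ a, a.1 ∈ C ↔ (φ a).1 ∈ B := by
    intro a
    simp only [hC, Finset.mem_image, Finset.mem_filter, Finset.mem_attach, true_and]
    exact ⟨fun ⟨b, hb, h⟩ => by rwa [← Subtype.ext h], fun h => ⟨a, h, rfl⟩⟩
  have hsub : C ⊆ f.rooms := by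
    intro x hx
    obtain ⟨a, -, rfl⟩ := Finset.mem_image.1 hx
    exact a.2
  have hint : ∀ d a, Internal g.rooms B d (φ a).1 → Internal f.rooms C d a.1 := by
    intro d a h c hc e he hs
    exact (hmem ⟨c, hc⟩).2 (h _ (φ ⟨c, hc⟩).2 e he ((hsh d e a ⟨c, hc⟩).1 hs))
  have hCI : Interlocked f.rooms C := by
    refine ⟨hsub, fun d a ha b hb hs => ?_, fun d a ha b hb hs => ?_⟩
    · exact hint d ⟨a, hsub ha⟩ (hI.internal_of_opp d _ ((hmem ⟨a, hsub ha⟩).1 ha) _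
        ((hmem ⟨b, hsub hb⟩).1 hb) ((hsh _ _ ⟨a, hsub ha⟩ ⟨b, hsub hb⟩).1 hs))
    · exact (hI.internal_or d _ ((hmem ⟨a, hsub ha⟩).1 ha) _
        ((hmem ⟨b, hsub hb⟩).1 hb) (fun h => hs ((hsh _ _ ⟨a, hsub ha⟩ ⟨b, hsub hb⟩).2 h))).imp
        (hint d ⟨a, hsub ha⟩) (hint d ⟨b, hsub hb⟩)
  have hback : ∀ b (hb : b ∈ B), (φ.symm ⟨b, hB.subset hb⟩).1 ∈ C := by
    intro b hb
    rw [hmem, φ.apply_symm_apply]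
    exact hb
  have hCcard : 1 < C.card := by
    obtain ⟨a, ha, b, hb, hab⟩ := Finset.one_lt_card.1 h1
    refine Finset.one_lt_card.2 ⟨_, hback a ha, _, hback b hb, fun h => hab ?_⟩
    simpa using h
  have hall := hf C hCI hCcard
  refine hne (hB.subset.antisymm fun b hb => ?_)
  have := (hmem (φ.symm ⟨b, hb⟩)).1 (by rw [hall]; exact (φ.symm ⟨b, hb⟩).2)
  rwa [φ.apply_symm_apply] at this

/-! ### A family of dissections without proper blocks

Around the unit square `center`, vertical and horizontal bars are added alternately, each new bar
covering the ends of the two preceding ones. All vertical bars end at the bottom edge of `upperLeft`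
and all horizontal bars at the left edge of `lowerRight`. -/

namespace Spiral

/-- The `i`-th vertical bar. -/
def vbar (i : ℕ) : Rect where
  x₁ := -(i + 1)
  x₂ := -i
  y₁ := -i
  y₂ := 2
  hx := by linarith
  hy := by have : (0 : ℝ) ≤ i := i.cast_nonneg; linarith

/-- The `i`-th horizontal bar. -/
def hbar (i : ℕ) : Rect where
  x₁ := -(i + 1)
  x₂ := 1
  y₁ := -(i + 1)
  y₂ := -i
  hx := by have : (0 : ℝ) ≤ i := i.cast_nonneg; linarith
  hy := by linarith

/-- The unit square. -/
def center : Rect := ⟨0, 1, 0, 1, by norm_num, by norm_num⟩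

/-- The room in the upper right corner. -/
def upperRight : Rect := ⟨0, 2, 1, 3, by norm_num, by norm_num⟩

/-- The room in the upper left corner, above `p` vertical bars. -/
def upperLeft (p : ℕ) (hp : 0 < p) : Rect where
  x₁ := -p
  x₂ := 0
  y₁ := 2
  y₂ := 3
  hx := by have : (0 : ℝ) < p := Nat.cast_pos.2 hp; linarith
  hy := by norm_num

/-- The room in the lower right corner, to the right of `q` horizontal bars. -/
def lowerRight (q : ℕ) : Rect where
  x₁ := 1
  x₂ := 2
  y₁ := -q
  y₂ := 1
  hx := by norm_num
  hy := by have : (0 : ℝ) ≤ q := q.cast_nonneg; linarith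

/-- The rectangle dissected by `p` vertical bars, `q` horizontal bars and four more rooms. -/
def frame (p q : ℕ) : Rect where
  x₁ := -p
  x₂ := 2
  y₁ := -q
  y₂ := 3
  hx := by have : (0 : ℝ) ≤ p := p.cast_nonneg; linarith
  hy := by have : (0 : ℝ) ≤ q := q.cast_nonneg; linarith

open Classical in
/-- The rooms of the dissection with `p` vertical and `q` horizontal bars. -/
noncomputable def rooms (p q : ℕ) (hp : 0 < p) : Finset Rect :=
  {upperLeft p hp, upperRight, lowerRight q, center} ∪
    ((Finset.range p).image vbar ∪ (Finset.range q).image hbar)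

variable {p q : ℕ} {hp : 0 < p}

theorem mem_rooms {a : Rect} : a ∈ rooms p q hp ↔
    a = upperLeft p hp ∨ a = upperRight ∨ a = lowerRight q ∨ a = center ∨
      (∃ i < p, a = vbar i) ∨ ∃ i < q, a = hbar i := by
  simp only [rooms, Finset.mem_union, Finset.mem_insert, Finset.mem_singleton, Finset.mem_image,
    Finset.mem_range, or_assoc, eq_comm]

theorem vbar_injective : Function.Injective vbar := fun i j h => by
  simpa [vbar] using congrArg Rect.x₂ h

theorem hbar_injective : Function.Injective hbar := fun i j h => by
  simpa [hbar] using congrArg Rect.y₂ h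

theorem card_rooms : (rooms p q hp).card = p + q + 4 := by
  classical
  have e : ∀ {a b : Rect}, a = b → ∀ d, a.coord d = b.coord d := fun h _ => h ▸ rfl
  have hq : (0 : ℝ) ≤ q := q.cast_nonneg
  have hi : ∀ i : ℕ, (0 : ℝ) ≤ i := fun i => i.cast_nonneg
  have h4 : ({upperLeft p hp, upperRight, lowerRight q, center} : Finset Rect).card = 4 := by
    rw [Finset.card_insert_of_notMem, Finset.card_insert_of_notMem,
      Finset.card_insert_of_notMem, Finset.card_singleton]
    · rw [Finset.mem_singleton]
      intro h
      have := e h .left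
      norm_num [lowerRight, center, Rect.coord] at this
    · simp only [Finset.mem_insert, Finset.mem_singleton]
      rintro (h | h)
      · have := e h .left
        norm_num [lowerRight, upperRight, Rect.coord] at this
      · have := e h .right
        norm_num [center, upperRight, Rect.coord] at this
    · simp only [Finset.mem_insert, Finset.mem_singleton]
      rintro (h | h | h)
      all_goals
        have := e h .right
        norm_num [upperLeft, upperRight, lowerRight, center, Rect.coord] at this
  have hvh : Disjoint ((Finset.range p).image vbar) ((Finset.range q).image hbar) := by
    simp only [Finset.disjoint_left, Finset.mem_image]
    rintro _ ⟨i, -, rfl⟩ ⟨j, -, h⟩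
    have := e h .top
    have := hi j
    simp only [vbar, hbar, Rect.coord] at *
    linarith
  rw [rooms, Finset.card_union_of_disjoint, Finset.card_union_of_disjoint hvh,
    Finset.card_image_of_injective _ vbar_injective,
    Finset.card_image_of_injective _ hbar_injective, Finset.card_range, Finset.card_range, h4,
    add_comm]
  simp only [Finset.disjoint_left, Finset.mem_insert, Finset.mem_singleton, Finset.mem_union,
    Finset.mem_image]
  rintro a (rfl | rfl | rfl | rfl) (⟨i, -, h⟩ | ⟨i, -, h⟩)
  all_goals
    have h1 := e h .top
    have h2 := e h .right
    have := hi i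
    simp only [vbar, hbar, upperLeft, upperRight, lowerRight, center, Rect.coord] at h1 h2
    linarith

/-- Passing from `n` to `n + 1` adds an L-shaped layer: its bottom is `hbar n`, the rest of its left
side is `vbar n`. -/
theorem exists_bar_of_mem (n : ℕ) : ∀ x y : ℝ, -(n : ℝ) ≤ x → x ≤ 1 → -(n : ℝ) ≤ y → y ≤ 2 →
    (x ≤ 0 ∨ y ≤ 1) → (x, y) ∈ center.region ∨ (x, y) ∈ upperRight.region ∨
      (∃ i < n, (x, y) ∈ (vbar i).region) ∨ ∃ i < n, (x, y) ∈ (hbar i).region := by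
  induction n with
  | zero =>
    intro x y h1 h2 h3 h4 h5
    simp only [Nat.cast_zero, neg_zero] at h1 h3
    rcases le_total y 1 with h | h
    · exact .inl ⟨⟨h1, h2⟩, h3, h⟩
    · refine .inr (.inl ⟨⟨h1, ?_⟩, h, ?_⟩) <;> simp only [upperRight] <;> linarith
  | succ n ih =>
    intro x y h1 h2 h3 h4 h5
    push_cast at h1 h3
    have hn : (0 : ℝ) ≤ n := n.cast_nonneg
    rcases le_total y (-n) with hy | hy
    · refine .inr (.inr (.inr ⟨n, n.lt_succ_self, ?_⟩))
      exact ⟨⟨by simpa [hbar] using h1, h2⟩, by simpa [hbar] using h3, hy⟩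
    · rcases le_total x (-n) with hx | hx
      · refine .inr (.inr (.inl ⟨n, n.lt_succ_self, ?_⟩))
        exact ⟨⟨by simpa [vbar] using h1, hx⟩, hy, h4⟩
      · rcases ih x y hx h2 hy h4 h5 with h | h | ⟨i, hi, h⟩ | ⟨i, hi, h⟩
        · exact .inl h
        · exact .inr (.inl h)
        · exact .inr (.inr (.inl ⟨i, by omega, h⟩))
        · exact .inr (.inr (.inr ⟨i, by omega, h⟩))

theorem region_subset_frame (hqp : q ≤ p) (hpq : p ≤ q + 1) {a : Rect} (ha : a ∈ rooms p q hp) :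
    a.region ⊆ (frame p q).region := by
  have hq : (0 : ℝ) ≤ q := q.cast_nonneg
  have hqp' : (q : ℝ) ≤ p := Nat.cast_le.2 hqp
  rw [Rect.region_subset_iff]
  rcases mem_rooms.1 ha with rfl | rfl | rfl | rfl | ⟨i, hi, rfl⟩ | ⟨i, hi, rfl⟩
  case inr.inr.inr.inr.inl =>
    have h1 : (i : ℝ) + 1 ≤ p := by exact_mod_cast hi
    -- When `p = q + 1`, the last vertical bar has index `q` and just reaches the bottom of the
    -- frame.
    have h2 : (i : ℝ) ≤ q := by exact_mod_cast (by omega : i ≤ q)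
    have h3 : (0 : ℝ) ≤ i := i.cast_nonneg
    refine ⟨⟨?_, ?_⟩, ?_, ?_⟩ <;> simp only [frame, vbar] <;> linarith
  case inr.inr.inr.inr.inr =>
    have h1 : (i : ℝ) + 1 ≤ q := by exact_mod_cast hi
    have h3 : (0 : ℝ) ≤ i := i.cast_nonneg
    refine ⟨⟨?_, ?_⟩, ?_, ?_⟩ <;> simp only [frame, hbar] <;> linarith
  all_goals
    refine ⟨⟨?_, ?_⟩, ?_, ?_⟩ <;>
      simp only [frame, upperLeft, upperRight, lowerRight, center] <;> linarith

theorem iUnion_region (hqp : q ≤ p) (hpq : p ≤ q + 1) :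
    (⋃ a ∈ rooms p q hp, a.region) = (frame p q).region := by
  refine Set.Subset.antisymm (Set.iUnion₂_subset fun a ha => region_subset_frame hqp hpq ha) ?_
  rintro ⟨x, y⟩ ⟨⟨h1, h2⟩, h3, h4⟩
  simp only [frame] at h1 h2 h3 h4
  have key : ∀ a ∈ rooms p q hp, (x, y) ∈ a.region → (x, y) ∈ ⋃ a ∈ rooms p q hp, a.region :=
    fun a ha h => Set.mem_iUnion₂.2 ⟨a, ha, h⟩
  have hbars : -(q : ℝ) ≤ x → x ≤ 1 → y ≤ 2 → (x ≤ 0 ∨ y ≤ 1) →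
      (x, y) ∈ ⋃ a ∈ rooms p q hp, a.region := by
    intro h5 h6 h7 h8
    rcases exists_bar_of_mem q x y h5 h6 h3 h7 h8 with h | h | ⟨i, hi, h⟩ | ⟨i, hi, h⟩
    · exact key _ (mem_rooms.2 (by simp)) h
    · exact key _ (mem_rooms.2 (by simp)) h
    · exact key (vbar i) (mem_rooms.2 (by simp [vbar_injective.eq_iff, hi.trans_le hqp])) h
    · exact key (hbar i) (mem_rooms.2 (by simp [hbar_injective.eq_iff, hi])) h
  rcases le_total x 0 with hx | hx
  · rcases le_total y 2 with hy | hy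
    · rcases le_total (-(q : ℝ)) x with hxq | hxq
      · exact hbars hxq (by linarith) hy (.inl hx)
      · rcases hpq.lt_or_eq with hlt | rfl
        · obtain rfl : p = q := by omega
          exact hbars h1 (by linarith) hy (.inl hx)
        -- With one more vertical than horizontal bar, the strip left of `-q` is exactly the last
        -- vertical bar.
        · refine key (vbar q) (mem_rooms.2 (by simp [vbar_injective.eq_iff])) ?_
          push_cast at h1
          exact ⟨⟨by simpa [vbar] using h1, hxq⟩, h3, hy⟩
    · exact key (upperLeft p hp) (mem_rooms.2 (by simp)) ⟨⟨h1, hx⟩, hy, h4⟩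
  · rcases le_total y 1 with hy | hy
    · rcases le_total x 1 with hx1 | hx1
      · have : (0 : ℝ) ≤ q := q.cast_nonneg
        exact hbars (by linarith) hx1 (by linarith) (.inr hy)
      · exact key (lowerRight q) (mem_rooms.2 (by simp)) ⟨⟨hx1, h2⟩, h3, hy⟩
    · exact key upperRight (mem_rooms.2 (by simp)) ⟨⟨hx, h2⟩, hy, h4⟩

theorem cast_separated {i j : ℕ} (h : i ≠ j) : (i : ℝ) + 1 ≤ j ∨ (j : ℝ) + 1 ≤ i := by
  rcases lt_or_gt_of_ne h with h | h
  · exact .inl (by exact_mod_cast h)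
  · exact .inr (by exact_mod_cast h)

theorem disjoint_vbar_hbar (i j : ℕ) : Disjoint (vbar i).inner (hbar j).inner := by
  rw [Rect.disjoint_inner_iff]
  simp only [vbar, hbar]
  rcases lt_or_ge j i with h | h
  · exact .inl (.inl (by have : (j : ℝ) + 1 ≤ i := by exact_mod_cast h
                         linarith))
  · exact .inr (.inr (by have : (i : ℝ) ≤ j := by exact_mod_cast h
                         linarith))

theorem disjoint_inner : ∀ a ∈ rooms p q hp, ∀ b ∈ rooms p q hp, a ≠ b →
    Disjoint a.inner b.inner := by
  intro a ha b hb hne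
  have hi : ∀ i : ℕ, (0 : ℝ) ≤ i := fun i => i.cast_nonneg
  have hi₁ : ∀ i : ℕ, -(i : ℝ) ≤ 1 := fun i => by linarith [hi i]
  have hi₂ : ∀ i : ℕ, -(i : ℝ) ≤ 2 := fun i => by linarith [hi i]
  rcases mem_rooms.1 ha with rfl | rfl | rfl | rfl | ⟨i, -, rfl⟩ | ⟨i, -, rfl⟩ <;>
    rcases mem_rooms.1 hb with rfl | rfl | rfl | rfl | ⟨j, -, rfl⟩ | ⟨j, -, rfl⟩ <;>
    first
    | exact absurd rfl hne
    | exact disjoint_vbar_hbar _ _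
    | exact (disjoint_vbar_hbar _ _).symm
    | skip
  case inr.inr.inr.inr.inl.inr.inr.inr.inr.inl =>
    rw [Rect.disjoint_inner_iff]
    simp only [vbar]
    rcases cast_separated fun h => hne (congrArg vbar h) with h | h
    · exact .inl (.inr (by linarith))
    · exact .inl (.inl (by linarith))
  case inr.inr.inr.inr.inr.inr.inr.inr.inr.inr =>
    rw [Rect.disjoint_inner_iff]
    simp only [hbar]
    rcases cast_separated fun h => hne (congrArg hbar h) with h | h
    · exact .inr (.inr (by linarith))
    · exact .inr (.inl (by linarith))
  all_goals
    rw [Rect.disjoint_inner_iff]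
    simp only [upperLeft, upperRight, lowerRight, center, vbar, hbar]
    simp [hi, hi₁, hi₂]

/-- Two of the four rooms suffice to exclude cross junctions: no upper right corner of a room is the
lower left corner of another. -/
theorem isMosaic (hqp : q ≤ p) (hpq : p ≤ q + 1) : IsMosaic (frame p q) (rooms p q hp) := by
  refine ⟨⟨iUnion_region hqp hpq, disjoint_inner⟩, ?_⟩
  rintro z ⟨a, ha, -, -, -, -, b, hb, h, -, -, h'⟩
  obtain ⟨h1, h2⟩ := Prod.mk.inj (h.symm.trans h')
  have hi : ∀ i : ℕ, (0 : ℝ) ≤ i := fun i => i.cast_nonneg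
  have hq := hi q
  have hp' : (0 : ℝ) < p := Nat.cast_pos.2 hp
  have hlt : ∀ {i n : ℕ}, i < n → (i : ℝ) + 1 ≤ n := fun h => by exact_mod_cast h
  rcases mem_rooms.1 ha with rfl | rfl | rfl | rfl | ⟨i, hip, rfl⟩ | ⟨i, hip, rfl⟩ <;>
    rcases mem_rooms.1 hb with rfl | rfl | rfl | rfl | ⟨j, hjp, rfl⟩ | ⟨j, hjp, rfl⟩ <;>
    simp only [upperLeft, upperRight, lowerRight, center, vbar, hbar] at h1 h2 <;>
    first
    | linarith
    -- Only a vertical bar against `upperLeft` and a horizontal bar against `lowerRight` need the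
    -- strict bound on the index.
    | (have := hlt hip; linarith)

end Spiral
-- Growth of interlocked sets in the spiral.
section Touching

variable {D B : Finset Rect} {d : Side} {a b c : Rect}

theorem Internal.mem_same (h : Internal D B d a) (ha : a ∈ D) (hc : c ∈ D)
    (ht : Touch d d a c) : c ∈ B :=
  h c hc d (.inl rfl) (ht.shares (.inl rfl) ha hc)

theorem Internal.mem_opp (h : Internal D B d a) (ha : a ∈ D) (hc : c ∈ D)
    (ht : Touch d d.opp a c) : c ∈ B :=
  h c hc d.opp (.inr rfl) (ht.shares (.inr rfl) ha hc)

/-- Rooms of `B` on opposite sides of a line make it internal, and `Internal.mem_same` and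
`Internal.mem_opp` then add further rooms along it. Alternating these rules drives all the arguments
below. -/
theorem Interlocked.internal_of_touch (h : Interlocked D B) (ha : a ∈ B) (hb : b ∈ B)
    (ht : Touch d d.opp a b) : Internal D B d a :=
  h.internal_of_opp d a ha b hb (ht.shares (.inr rfl) (h.subset ha) (h.subset hb))

end Touching

namespace Spiral

attribute [local simp] Touch Rect.coord Rect.lo Rect.hi Side.opp vbar hbar center upperLeft
  upperRight lowerRight

variable {p q : ℕ} {hp : 0 < p} {B : Finset Rect}

theorem upperLeft_mem : upperLeft p hp ∈ rooms p q hp := mem_rooms.2 (.inl rfl)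

theorem upperRight_mem : upperRight ∈ rooms p q hp := mem_rooms.2 (.inr (.inl rfl))

theorem lowerRight_mem : lowerRight q ∈ rooms p q hp := mem_rooms.2 (.inr (.inr (.inl rfl)))

theorem center_mem : center ∈ rooms p q hp := mem_rooms.2 (.inr (.inr (.inr (.inl rfl))))

theorem vbar_mem {i : ℕ} (hi : i < p) : vbar i ∈ rooms p q hp :=
  mem_rooms.2 (.inr (.inr (.inr (.inr (.inl ⟨i, hi, rfl⟩)))))

theorem hbar_mem {i : ℕ} (hi : i < q) : hbar i ∈ rooms p q hp :=
  mem_rooms.2 (.inr (.inr (.inr (.inr (.inr ⟨i, hi, rfl⟩)))))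

theorem touch_upperLeft_vbar {i : ℕ} (hi : i < p) :
    Touch .bottom .top (upperLeft p hp) (vbar i) := by
  have : (i : ℝ) + 1 ≤ p := by exact_mod_cast hi
  refine ⟨?_, ?_, ?_⟩ <;> simp <;> linarith

theorem touch_lowerRight_hbar {i : ℕ} (hi : i < q) :
    Touch .left .right (lowerRight q) (hbar i) := by
  have : (i : ℝ) + 1 ≤ q := by exact_mod_cast hi
  refine ⟨?_, ?_, ?_⟩ <;> simp <;> linarith

theorem touch_hbar_vbar (i : ℕ) : Touch .top .bottom (hbar i) (vbar i) := by
  have : (0 : ℝ) ≤ i := i.cast_nonneg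
  refine ⟨?_, ?_, ?_⟩ <;> simp
  linarith

theorem touch_vbar_vbar (i : ℕ) : Touch .right .left (vbar (i + 1)) (vbar i) := by
  have : (0 : ℝ) ≤ i := i.cast_nonneg
  refine ⟨?_, ?_, ?_⟩ <;> simp <;> linarith

theorem touch_vbar_hbar (i : ℕ) : Touch .right .left (vbar (i + 1)) (hbar i) := by
  have : (0 : ℝ) ≤ i := i.cast_nonneg
  refine ⟨?_, ?_, ?_⟩ <;> simp
  linarith

theorem touch_hbar_hbar (i : ℕ) : Touch .top .bottom (hbar (i + 1)) (hbar i) := by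
  have : (0 : ℝ) ≤ i := i.cast_nonneg
  refine ⟨?_, ?_, ?_⟩ <;> simp <;> linarith

/-- The core of the growth: the line `x = 0` brings in both upper rooms, and the line `y = 1` brings
in `lowerRight`. The bottom of `upperLeft` then collects all vertical bars, the left side of
`lowerRight` all horizontal ones. -/
theorem eq_rooms_of_vbar_center (h : Interlocked (rooms p q hp) B) (hv : vbar 0 ∈ B)
    (hc : center ∈ B) : B = rooms p q hp := by
  have i1 := h.internal_of_touch (d := .right) hv hc (by simp)
  have hA : upperLeft p hp ∈ B := i1.mem_same (h.subset hv) upperLeft_mem (by norm_num)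
  have hA' : upperRight ∈ B := i1.mem_opp (h.subset hv) upperRight_mem (by norm_num)
  have i2 := h.internal_of_touch (d := .bottom) hA' hc (by norm_num)
  have hC : lowerRight q ∈ B := i2.mem_opp (h.subset hA') lowerRight_mem (by norm_num)
  have i3 := h.internal_of_touch (d := .bottom) hA hv (touch_upperLeft_vbar hp)
  have i4 := h.internal_of_touch (d := .left) hC hc (by
    have : (0 : ℝ) ≤ q := q.cast_nonneg
    simp
    linarith)
  refine h.subset.antisymm fun a ha => ?_
  rcases mem_rooms.1 ha with rfl | rfl | rfl | rfl | ⟨i, hi, rfl⟩ | ⟨i, hi, rfl⟩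
  · exact hA
  · exact hA'
  · exact hC
  · exact hc
  · exact i3.mem_opp (h.subset hA) ha (touch_upperLeft_vbar hi)
  · exact i4.mem_opp (h.subset hC) ha (touch_lowerRight_hbar hi)

/-- Descent along the spiral: the line between the two bars also meets the preceding horizontal bar,
and the line between that one and the vertical bar meets the preceding vertical bar. At index `0`
the descent reaches `center`. -/
theorem eq_rooms_of_vbar_hbar (h : Interlocked (rooms p q hp) B) :
    ∀ i, vbar i ∈ B → hbar i ∈ B → i < p → i < q → B = rooms p q hp := by
  intro i
  induction i with
  | zero =>
    intro hv hh _ _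
    have i1 := h.internal_of_touch (d := .top) hh hv (touch_hbar_vbar 0)
    exact eq_rooms_of_vbar_center h hv
      (i1.mem_opp (h.subset hh) center_mem (by norm_num))
  | succ i ih =>
    intro hv hh hip hiq
    have i1 := h.internal_of_touch (d := .top) hh hv (touch_hbar_vbar (i + 1))
    have hh' := i1.mem_opp (h.subset hh) (hbar_mem (i.lt_succ_self.trans hiq)) (touch_hbar_hbar i)
    have i2 := h.internal_of_touch (d := .right) hv hh' (touch_vbar_hbar i)
    exact ih (i2.mem_opp (h.subset hv) (vbar_mem (i.lt_succ_self.trans hip)) (touch_vbar_vbar i))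
      hh' (by omega) (by omega)

theorem eq_rooms_of_vbar_succ_hbar (h : Interlocked (rooms p q hp) B) {i : ℕ}
    (hv : vbar (i + 1) ∈ B) (hh : hbar i ∈ B) (hip : i < p) (hiq : i < q) : B = rooms p q hp := by
  have i1 := h.internal_of_touch (d := .right) hv hh (touch_vbar_hbar i)
  exact eq_rooms_of_vbar_hbar h i
    (i1.mem_opp (h.subset hv) (vbar_mem hip) (touch_vbar_vbar i)) hh hip hiq

theorem eq_rooms_of_upperLeft_internal (h : Interlocked (rooms p q hp) B) (hp₂ : 1 < p)
    (hq : 0 < q) (hi : Internal (rooms p q hp) B .bottom (upperLeft p hp)) :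
    B = rooms p q hp := by
  have hv₀ := hi.mem_opp upperLeft_mem (vbar_mem hp) (touch_upperLeft_vbar hp)
  have hv₁ := hi.mem_opp upperLeft_mem (vbar_mem hp₂) (touch_upperLeft_vbar hp₂)
  have i1 := h.internal_of_touch (d := .right) hv₁ hv₀ (touch_vbar_vbar 0)
  exact eq_rooms_of_vbar_hbar h 0 hv₀
    (i1.mem_opp (h.subset hv₁) (hbar_mem hq) (touch_vbar_hbar 0)) hp hq

theorem eq_rooms_of_upperLeft_vbar (h : Interlocked (rooms p q hp) B) (hp₂ : 1 < p)
    (hq : 0 < q) (ha : upperLeft p hp ∈ B) {i : ℕ} (hi : i < p) (hv : vbar i ∈ B) :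
    B = rooms p q hp :=
  eq_rooms_of_upperLeft_internal h hp₂ hq
    (h.internal_of_touch (d := .bottom) ha hv (touch_upperLeft_vbar hi))

theorem eq_rooms_of_lowerRight_internal (h : Interlocked (rooms p q hp) B)
    (hq : 0 < q) (hi : Internal (rooms p q hp) B .left (lowerRight q)) :
    B = rooms p q hp := by
  have hc : center ∈ B := hi.mem_opp lowerRight_mem center_mem (by
    have : (0 : ℝ) ≤ q := q.cast_nonneg
    simp
    linarith)
  have hh := hi.mem_opp lowerRight_mem (hbar_mem hq) (touch_lowerRight_hbar hq)
  have i1 := h.internal_of_touch (d := .top) hh hc (by norm_num)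
  exact eq_rooms_of_vbar_center h (i1.mem_opp (h.subset hh) (vbar_mem hp) (touch_hbar_vbar 0)) hc

theorem eq_rooms_of_lowerRight_hbar (h : Interlocked (rooms p q hp) B)
    (hq : 0 < q) (ha : lowerRight q ∈ B) {i : ℕ} (hi : i < q) (hh : hbar i ∈ B) :
    B = rooms p q hp :=
  eq_rooms_of_lowerRight_internal h hq
    (h.internal_of_touch (d := .left) ha hh (touch_lowerRight_hbar hi))

theorem eq_rooms_of_lowerRight_center (h : Interlocked (rooms p q hp) B)
    (hq : 0 < q) (ha : lowerRight q ∈ B) (hc : center ∈ B) :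
    B = rooms p q hp :=
  eq_rooms_of_lowerRight_internal h hq (h.internal_of_touch (d := .left) ha hc (by
    have : (0 : ℝ) ≤ q := q.cast_nonneg
    simp
    linarith))

theorem eq_rooms_of_upperRight_upperLeft (h : Interlocked (rooms p q hp) B)
    (ha : upperRight ∈ B) (hb : upperLeft p hp ∈ B) : B = rooms p q hp := by
  have i1 := h.internal_of_touch (d := .left) ha hb (by norm_num)
  exact eq_rooms_of_vbar_center h (i1.mem_opp (h.subset ha) (vbar_mem hp) (by norm_num))
    (i1.mem_same (h.subset ha) center_mem (by norm_num))

theorem eq_rooms_of_upperRight_lowerRight (h : Interlocked (rooms p q hp) B) (hq : 0 < q)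
    (ha : upperRight ∈ B) (hb : lowerRight q ∈ B) : B = rooms p q hp := by
  have i1 := h.internal_of_touch (d := .bottom) ha hb (by norm_num)
  exact eq_rooms_of_lowerRight_center h hq hb
    (i1.mem_opp (h.subset ha) center_mem (by norm_num))

/-- As for the other rooms below, every side, even one on the outer frame, meets or continues an
edge of a neighbour which together with this room already forces everything. -/
theorem eq_rooms_of_internal_upperLeft (h : Interlocked (rooms p q hp) B) (hp₂ : 1 < p)
    (hq : 0 < q) (ha : upperLeft p hp ∈ B) {d : Side}
    (hi : Internal (rooms p q hp) B d (upperLeft p hp)) : B = rooms p q hp := by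
  cases d
  -- The last vertical bar also has its left edge on the outer frame.
  · refine eq_rooms_of_upperLeft_vbar h hp₂ hq ha (i := p - 1) (by omega)
      (hi.mem_same upperLeft_mem (vbar_mem (by omega)) ?_)
    have : ((p - 1 : ℕ) : ℝ) = p - 1 := by rw [Nat.cast_sub hp, Nat.cast_one]
    refine ⟨?_, ?_, ?_⟩ <;> simp [this]
    have : (1 : ℝ) < p := by exact_mod_cast hp₂
    linarith
  · exact eq_rooms_of_upperRight_upperLeft h
      (hi.mem_opp upperLeft_mem upperRight_mem (by norm_num)) ha
  · exact eq_rooms_of_upperLeft_internal h hp₂ hq hi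
  · exact eq_rooms_of_upperRight_upperLeft h
      (hi.mem_same upperLeft_mem upperRight_mem (by
        have : (0 : ℝ) ≤ p := p.cast_nonneg
        simp
        linarith)) ha

theorem eq_rooms_of_internal_upperRight (h : Interlocked (rooms p q hp) B)
    (hq : 0 < q) (ha : upperRight ∈ B) {d : Side}
    (hi : Internal (rooms p q hp) B d upperRight) : B = rooms p q hp := by
  cases d
  · exact eq_rooms_of_upperRight_upperLeft h ha
      (hi.mem_opp upperRight_mem upperLeft_mem (by norm_num))
  · exact eq_rooms_of_upperRight_lowerRight h hq ha
      (hi.mem_same upperRight_mem lowerRight_mem (by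
        have : (0 : ℝ) ≤ q := q.cast_nonneg
        simp
        linarith))
  · exact eq_rooms_of_upperRight_lowerRight h hq ha
      (hi.mem_opp upperRight_mem lowerRight_mem (by norm_num))
  · exact eq_rooms_of_upperRight_upperLeft h ha
      (hi.mem_same upperRight_mem upperLeft_mem (by
        have : (0 : ℝ) ≤ p := p.cast_nonneg
        simp
        linarith))

theorem eq_rooms_of_internal_lowerRight (h : Interlocked (rooms p q hp) B)
    (hq : 0 < q) (ha : lowerRight q ∈ B) {d : Side}
    (hi : Internal (rooms p q hp) B d (lowerRight q)) : B = rooms p q hp := by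
  have hq' : (1 : ℝ) ≤ q := by exact_mod_cast hq
  cases d
  · exact eq_rooms_of_lowerRight_internal h hq hi
  · exact eq_rooms_of_upperRight_lowerRight h hq
      (hi.mem_same lowerRight_mem upperRight_mem (by
        simp
        linarith)) ha
  · refine eq_rooms_of_lowerRight_hbar h hq ha (i := q - 1) (by omega)
      (hi.mem_same lowerRight_mem (hbar_mem (by omega)) ?_)
    have : ((q - 1 : ℕ) : ℝ) = q - 1 := by rw [Nat.cast_sub hq, Nat.cast_one]
    refine ⟨?_, ?_, ?_⟩ <;> simp [this]
    linarith
  · exact eq_rooms_of_upperRight_lowerRight h hq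
      (hi.mem_opp lowerRight_mem upperRight_mem (by norm_num)) ha

theorem eq_rooms_of_internal_center (h : Interlocked (rooms p q hp) B)
    (hq : 0 < q) (ha : center ∈ B) {d : Side}
    (hi : Internal (rooms p q hp) B d center) : B = rooms p q hp := by
  have hq' : (1 : ℝ) ≤ q := by exact_mod_cast hq
  cases d
  · exact eq_rooms_of_vbar_center h (hi.mem_opp center_mem (vbar_mem hp) (by norm_num)) ha
  · exact eq_rooms_of_lowerRight_center h hq (hi.mem_opp center_mem lowerRight_mem (by
        simp
        linarith)) ha
  · exact eq_rooms_of_vbar_center h (hi.mem_same center_mem (vbar_mem hp) (by norm_num)) ha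
  · exact eq_rooms_of_lowerRight_center h hq
      (hi.mem_same center_mem lowerRight_mem (by norm_num)) ha

theorem eq_rooms_of_internal_vbar (h : Interlocked (rooms p q hp) B) (hp₂ : 1 < p)
    (hq : 0 < q) (hpq : p ≤ q + 1) {i : ℕ} (hip : i < p) (ha : vbar i ∈ B) {d : Side}
    (hi : Internal (rooms p q hp) B d (vbar i)) : B = rooms p q hp := by
  have hi₀ : (0 : ℝ) ≤ i := i.cast_nonneg
  have hm := h.subset ha
  cases d
  · rcases lt_or_ge i q with hiq | hiq
    · refine eq_rooms_of_vbar_hbar h i ha (hi.mem_same hm (hbar_mem hiq) ?_) hip hiq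
      refine ⟨?_, ?_, ?_⟩ <;> simp
      linarith
    -- No horizontal bar of this index exists, so the left edge lies on the outer frame, below that
    -- of `upperLeft`.
    · obtain rfl : p = i + 1 := by omega
      refine eq_rooms_of_upperLeft_vbar h hp₂ hq (hi.mem_same hm upperLeft_mem ?_) hip ha
      refine ⟨?_, ?_, ?_⟩ <;> simp
      linarith
  · cases i with
    | zero => exact eq_rooms_of_vbar_center h ha (hi.mem_opp hm center_mem (by norm_num))
    | succ i =>
      exact eq_rooms_of_vbar_succ_hbar h ha
        (hi.mem_opp hm (hbar_mem (by omega)) (touch_vbar_hbar i)) (by omega) (by omega)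
  · cases i with
    | zero => exact eq_rooms_of_vbar_center h ha (hi.mem_same hm center_mem (by norm_num))
    | succ i =>
      refine eq_rooms_of_vbar_succ_hbar h ha (hi.mem_same hm (hbar_mem (by omega)) ?_)
        (by omega) (by omega)
      push_cast at hi₀
      refine ⟨?_, ?_, ?_⟩ <;> simp
      linarith
  · refine eq_rooms_of_upperLeft_vbar h hp₂ hq (hi.mem_opp hm upperLeft_mem ?_) hip ha
    obtain ⟨h1, h2, h3⟩ := touch_upperLeft_vbar (hp := hp) hip
    exact ⟨h1.symm, h3, h2⟩

theorem eq_rooms_of_internal_hbar (h : Interlocked (rooms p q hp) B)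
    (hq : 0 < q) (hqp : q ≤ p) {i : ℕ} (hiq : i < q) (ha : hbar i ∈ B) {d : Side}
    (hi : Internal (rooms p q hp) B d (hbar i)) : B = rooms p q hp := by
  have hi₀ : (0 : ℝ) ≤ i := i.cast_nonneg
  have hm := h.subset ha
  have hip := hiq.trans_le hqp
  cases d
  · refine eq_rooms_of_vbar_hbar h i (hi.mem_same hm (vbar_mem hip) ?_) ha hip hiq
    refine ⟨?_, ?_, ?_⟩ <;> simp
    linarith
  · refine eq_rooms_of_lowerRight_hbar h hq (hi.mem_opp hm lowerRight_mem ?_) hiq ha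
    obtain ⟨h1, h2, h3⟩ := touch_lowerRight_hbar hiq
    exact ⟨h1.symm, h3, h2⟩
  · rcases lt_or_ge (i + 1) p with hip' | hip'
    · refine eq_rooms_of_vbar_succ_hbar h (hi.mem_same hm (vbar_mem hip') ?_) ha hip hiq
      refine ⟨?_, ?_, ?_⟩ <;> simp
      linarith
    -- The last horizontal bar with no later vertical bar: its bottom edge lies on the outer frame,
    -- next to that of `lowerRight`.
    · obtain rfl : q = i + 1 := by omega
      refine eq_rooms_of_lowerRight_hbar h hq (hi.mem_same hm lowerRight_mem ?_) hiq ha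
      refine ⟨?_, ?_, ?_⟩ <;> simp
      linarith
  · exact eq_rooms_of_vbar_hbar h i (hi.mem_opp hm (vbar_mem hip) (touch_hbar_vbar i)) ha hip hiq

theorem eq_rooms_of_internal (h : Interlocked (rooms p q hp) B) (hp₂ : 1 < p)
    (hq : 0 < q) (hqp : q ≤ p) (hpq : p ≤ q + 1) {a : Rect} (ha : a ∈ B) {d : Side}
    (hi : Internal (rooms p q hp) B d a) : B = rooms p q hp := by
  rcases mem_rooms.1 (h.subset ha) with rfl | rfl | rfl | rfl | ⟨i, hip, rfl⟩ | ⟨i, hiq, rfl⟩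
  · exact eq_rooms_of_internal_upperLeft h hp₂ hq ha hi
  · exact eq_rooms_of_internal_upperRight h hq ha hi
  · exact eq_rooms_of_internal_lowerRight h hq ha hi
  · exact eq_rooms_of_internal_center h hq ha hi
  · exact eq_rooms_of_internal_vbar h hp₂ hq hpq hip ha hi
  · exact eq_rooms_of_internal_hbar h hq hqp hiq ha hi

/-- The dissections of this family have no proper blocks of at least two rooms. -/
theorem eq_rooms_of_one_lt_card (h : Interlocked (rooms p q hp) B) (hp₂ : 1 < p)
    (hq : 0 < q) (hqp : q ≤ p) (hpq : p ≤ q + 1) (hB : 1 < B.card) : B = rooms p q hp := by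
  obtain ⟨a, ha, b, hb, hab⟩ := Finset.one_lt_card.1 hB
  obtain ⟨d, hd⟩ : ∃ d, a.coord d ≠ b.coord d := by
    by_contra! hcon
    exact hab (Rect.eq_of_coord hcon)
  rcases h.internal_or d a ha b hb fun hs => hd (hs.coord_eq (.inl rfl)) with hi | hi
  · exact eq_rooms_of_internal h hp₂ hq hqp hpq ha hi
  · exact eq_rooms_of_internal h hp₂ hq hqp hpq hb hi

end Spiral

end Floorplan

theorem theorem1 (k : ℕ) (hk : 7 ≤ k) :
    Floorplan.HFO (k - 1) ⊆ Floorplan.HFO k ∧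
      (Floorplan.HFO k \ Floorplan.HFO (k - 1)).Nonempty := by
  refine ⟨Floorplan.HFO_mono (Nat.sub_le k 1), ?_⟩
  obtain ⟨p, q, hp, hq, hqp, hpq, hsum⟩ :
      ∃ p q, 1 < p ∧ 0 < q ∧ q ≤ p ∧ p ≤ q + 1 ∧ p + q + 4 = k :=
    -- The `k - 4` bars are split as evenly as possible, with the odd one vertical; `7 ≤ k` provides
    -- the required two vertical bars and one horizontal bar.
    ⟨(k - 3) / 2, (k - 4) / 2, by omega, by omega, by omega, by omega, by omega⟩
  have hp₀ : 0 < p := by omega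
  have hcard := Floorplan.Spiral.card_rooms (p := p) (q := q) (hp := hp₀)
  have hmos := Floorplan.Spiral.isMosaic (hp := hp₀) hqp hpq
  refine ⟨Quotient.mk _ ⟨_, _, hmos⟩, ⟨_, rfl, ?_⟩, ?_⟩
  · exact Floorplan.hierarchical_of_isMosaic hmos (hcard.trans hsum).le
  · have hlt : k - 1 < (Floorplan.Spiral.rooms p q hp₀).card := by omega
    exact Floorplan.notMem_HFO (by omega) _ hlt fun B hB h1 =>
      Floorplan.Spiral.eq_rooms_of_one_lt_card hB hp hq hqp hpq h1
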